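/- **Exponents.** Let $n\ge 1$ and $\underline\zeta=(\zeta_1,\dots,\zeta_n)\in\mathbb R^n$. Let $w_n(\underline\zeta)$ (resp. $\widehat w_n(\underline\zeta)$) be the supremum in $[-\infty,\infty]$ of all real $\nu$ such that for arbitrarily large $X$ (resp. for all sufficiently large $X$) there is a non-zero $(x,y_1,\dots,y_n)\in\mathbb Z^{n+1}$ with $\max\{|x|,|y_1|,\dots,|y_n|\}\le X$ and $|x+\zeta_1y_1+\dots+\zeta_ny_n|\le X^{-\nu}$. Let $\lambda_n(\underline\zeta)$ (resp. $\widehat\lambda_n(\underline\zeta)$) be defined in the same way with the conditions $|x|\le X$ and $\max_{1\le i\le n}|\zeta_ix-y_i|\le X^{-\nu}$. For real $\zeta$ write $w_n(\zeta)=w_n(\zeta,\zeta^2,\dots,\zeta^n)$ and $\widehat w_n(\zeta)=\widehat w_n(\zeta,\zeta^2,\dots,\zeta^n)$. Let $\widehat w_n^{*}(\zeta)$ be the supremum of all real $\nu$ such that for all sufficiently large $X$ there is a real algebraic number $\alpha$ of degree at most $n$ with $H(\alpha)\le X$ and $0<|\zeta-\alpha|\le H(\alpha)^{-1}X^{-\nu}$,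 where $H(\alpha)$ is the maximum modulus of the coefficients of the irreducible polynomial of $\alpha$ in $\mathbb Z[X]$. **Regular graph.** For $\rho>1$ the regular graph in dimension $n$ with ratio $\rho$ consists of the functions $L_1\le\dots\le L_{n+1}$ on $(0,\infty)$ such that $L_j(\rho q)=\rho L_j(q)$ for all $q>0$ and all $j$; for $1\le q\le\rho$ the multiset $\{L_1(q),\dots,L_{n+1}(q)\}$ consists of $L_{n+1}(1)-(q-1)$ and of $L_j(1)+(q-1)/n$, $1\le j\le n$; and $L_1(\rho)=L_{n+1}(1)-(\rho-1)$. For $\rho=1$ put $L_j=0$ for all $j$. Its constants $\lambda_{n,j},\widehat\lambda_{n,j}$ are given by $$(1+\lambda_{n,j})\Bigl(1+\liminf_{q\to\infty}\tfrac{L_j(q)}q\Bigr)=(1+\widehat\lambda_{n,j})\Bigl(1+\limsup_{q\to\infty}\tfrac{L_j(q)}q\Bigr)=\tfrac{n+1}n ,$$ and one puts $\lambda_n=\lambda_{n,1}$, $\widehat\lambda_n=\widehat\lambda_{n,1}$, $w_n=1/\widehat\lambda_{n,n+1}$, $\widehat w_n=1/\lambda_{n,n+1}$. In the degenerate regular graph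 ($\rho=\infty$), $\lambda_n=w_n=\infty$, $\widehat\lambda_n=1$, and $\widehat w_n=\infty$ if $n\ge2$, $\widehat w_1=1$. Let $\phi_n$ be the function on $[n,\infty]$ that expresses $\widehat w_n$ in terms of $w_n$ in the regular graphs in dimension $n$, and $\vartheta_n$ the function on $[1/n,\infty]$ that expresses $\widehat\lambda_n$ in terms of $\lambda_n$. **Schmidt–Summerer conjecture in dimension $n$.** For every $\underline\zeta\in\mathbb R^n$ such that $1,\zeta_1,\dots,\zeta_n$ are linearly independent over $\mathbb Q$, one has $\widehat w_n(\underline\zeta)\le\phi_n(w_n(\underline\zeta))$ and $\widehat\lambda_n(\underline\zeta)\le\vartheta_n(\lambda_n(\underline\zeta))$. **Theorem.** Suppose that the Schmidt–Summerer conjecture holds in every dimension $n\ge2$. The equation $ye^{1/y}=2\sqrt e$ has exactly one solution $y=\tau$ in $(0,1)$; put $\Delta=\log(2/\tau)+1$. Then $|\tau-0.5693|<10^{-4}$ and $|\Delta-2.2564|<10^{-4}$, and the following hold. 1. For every $\varepsilon>0$ there is an integer $n_0=n_0(\varepsilon)\ge3$ such that for all real transcendental numbers $\zeta$ and all $n\ge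 n_0$ $$\widehat w_n^{*}(\zeta)\le 2n-\Delta+\varepsilon ,$$ and moreover $\widehat w_n(\zeta)\le 2n-\Delta+\varepsilon$ unless $w_{n-2}(\zeta)<w_{n-1}(\zeta)=w_n(\zeta)$. 2. For all real transcendental numbers $\zeta$ and all $n\ge10$, $\widehat w_n(\zeta)\le 2n-2$. -/

import Mathlib

open Filter

noncomputable section

namespace UniformApprox

/-! ### Exponents of Diophantine approximation

All exponents are suprema of sets of real numbers, taken in `EReal`, so that the value `∞` is
represented by `⊤`. -/

/-- `(x, y)` is a non-zero integer vector with `max (|x|, |y₁|, …, |yₙ|) ≤ X` and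
`|x + ζ₁ y₁ + ⋯ + ζₙ yₙ| ≤ X ^ (-ν)`. -/
def IsLinFormSolution {n : ℕ} (ζ : Fin n → ℝ) (X ν : ℝ) (x : ℤ) (y : Fin n → ℤ) : Prop :=
  (x ≠ 0 ∨ y ≠ 0) ∧ |(x : ℝ)| ≤ X ∧ (∀ i, |(y i : ℝ)| ≤ X) ∧
    |(x : ℝ) + ∑ i, ζ i * (y i : ℝ)| ≤ X ^ (-ν)

/-- The exponent `wₙ(ζ)`: solutions exist for arbitrarily large `X`. -/
def wOrd {n : ℕ} (ζ : Fin n → ℝ) : EReal :=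
  sSup ((fun ν : ℝ => (ν : EReal)) ''
    {ν : ℝ | ∃ᶠ X : ℝ in atTop, ∃ x y, IsLinFormSolution ζ X ν x y})

/-- The uniform exponent `ŵₙ(ζ)`: solutions exist for all large `X`. -/
def wHat {n : ℕ} (ζ : Fin n → ℝ) : EReal :=
  sSup ((fun ν : ℝ => (ν : EReal)) ''
    {ν : ℝ | ∀ᶠ X : ℝ in atTop, ∃ x y, IsLinFormSolution ζ X ν x y})

/-- `(x, y)` is a non-zero integer vector with `|x| ≤ X` and `|ζᵢ x - yᵢ| ≤ X ^ (-ν)`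
for all `i`. -/
def IsSimulSolution {n : ℕ} (ζ : Fin n → ℝ) (X ν : ℝ) (x : ℤ) (y : Fin n → ℤ) : Prop :=
  (x ≠ 0 ∨ y ≠ 0) ∧ |(x : ℝ)| ≤ X ∧ ∀ i, |ζ i * (x : ℝ) - (y i : ℝ)| ≤ X ^ (-ν)

/-- The exponent `λₙ(ζ)` of simultaneous approximation. -/
def lamOrd {n : ℕ} (ζ : Fin n → ℝ) : EReal :=
  sSup ((fun ν : ℝ => (ν : EReal)) ''
    {ν : ℝ | ∃ᶠ X : ℝ in atTop, ∃ x y, IsSimulSolution ζ X ν x y})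

/-- The uniform exponent `λ̂ₙ(ζ)` of simultaneous approximation. -/
def lamHat {n : ℕ} (ζ : Fin n → ℝ) : EReal :=
  sSup ((fun ν : ℝ => (ν : EReal)) ''
    {ν : ℝ | ∀ᶠ X : ℝ in atTop, ∃ x y, IsSimulSolution ζ X ν x y})

/-- The vector `(ζ, ζ², …, ζⁿ)`. -/
def powers (n : ℕ) (ζ : ℝ) : Fin n → ℝ := fun i => ζ ^ ((i : ℕ) + 1)

/-- `P` is the minimal polynomial over `ℤ` of the real algebraic number `α` (it is unique up to
sign): irreducible in `ℤ[X]`, hence primitive, with root `α`. -/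
def IsIntMinpoly (P : Polynomial ℤ) (α : ℝ) : Prop :=
  Irreducible P ∧ Polynomial.aeval α P = 0

/-- The uniform exponent `ŵₙ*(ζ)` of approximation by real algebraic numbers `α` of degree at
most `n`. The height `H(α)` is the maximum modulus `P.supNorm` of the coefficients of the minimal
polynomial `P` of `α`. -/
def wStarHat (n : ℕ) (ζ : ℝ) : EReal :=
  sSup ((fun ν : ℝ => (ν : EReal)) ''
    {ν : ℝ | ∀ᶠ X : ℝ in atTop, ∃ (α : ℝ) (P : Polynomial ℤ), IsIntMinpoly P α ∧
      P.natDegree ≤ n ∧ P.supNorm ≤ X ∧ 0 < |ζ - α| ∧ |ζ - α| ≤ P.supNorm⁻¹ * X ^ (-ν)})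

/-! ### The regular graph -/

/-- The (idealized) regular graph in dimension `n` with ratio `ρ ∈ [1, ∞)`: the combined graph of
the successive minima functions `L₁(q) ≤ ⋯ ≤ Lₙ₊₁(q)`, `q > 0`, indexed here by `Fin (n + 1)`.
At any time one of the `n + 1` branches falls with slope `-1`, and the others rise with
slope `1 / n`. In the regular graph each branch that starts to fall does so from the top position
and falls without interruption down to the bottom position; at that moment the branch which is then
on top starts to fall. The successive falling periods are `[ρᵏ, ρᵏ⁺¹]` (this normalizes the scale
of `q`), and the pattern is self-similar with ratio `ρ`. For `ρ = 1` all functions vanish. -/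
def IsRegularGraph (n : ℕ) (ρ : ℝ) (L : Fin (n + 1) → ℝ → ℝ) : Prop :=
  (ρ = 1 ∧ ∀ j q, L j q = 0) ∨
  (1 < ρ ∧
    (∀ q, 0 < q → Monotone fun j => L j q) ∧
    (∀ q, 0 < q → ∀ j, L j (ρ * q) = ρ * L j q) ∧
    (∀ q ∈ Set.Icc 1 ρ,
      (Finset.univ : Finset (Fin (n + 1))).val.map (fun j => L j q) =
        (L (Fin.last n) 1 - (q - 1)) ::ₘ
          (Finset.univ : Finset (Fin n)).val.map (fun j => L j.castSucc 1 + (q - 1) / n)) ∧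
    L 0 ρ = L (Fin.last n) 1 - (ρ - 1))

/-- The exponent `λₙ,ⱼ` belonging to a combined graph, given by
`(1 + λₙ,ⱼ) (1 + liminf Lⱼ(q)/q) = (n + 1) / n`. -/
def graphLam {n : ℕ} (L : Fin (n + 1) → ℝ → ℝ) (j : Fin (n + 1)) : ℝ :=
  ((n : ℝ) + 1) / n / (1 + liminf (fun q => L j q / q) atTop) - 1

/-- The exponent `λ̂ₙ,ⱼ` belonging to a combined graph, given by
`(1 + λ̂ₙ,ⱼ) (1 + limsup Lⱼ(q)/q) = (n + 1) / n`. -/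
def graphLamHat {n : ℕ} (L : Fin (n + 1) → ℝ → ℝ) (j : Fin (n + 1)) : ℝ :=
  ((n : ℝ) + 1) / n / (1 + limsup (fun q => L j q / q) atTop) - 1

/-- The function `φₙ` expressing `ŵₙ` in terms of `wₙ ∈ [n, ∞]` in the regular graph, where
`wₙ = 1 / λ̂ₙ,ₙ₊₁` and `ŵₙ = 1 / λₙ,ₙ₊₁`. For `wₙ ∈ [n, ∞)` the set below has exactly one element.
In the degenerate regular graph `wₙ = ∞` one has `λₙ,₁ = ∞`, `λₙ,₂ = 1` and `λₙ,ⱼ = 0`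
for `j ≥ 3`, so that `ŵₙ = 1 / λₙ,ₙ₊₁` is `∞` for `n ≥ 2` and is `1` for `n = 1`. -/
def phi (n : ℕ) (w : EReal) : EReal :=
  sSup {v : EReal |
    (∃ (ρ : ℝ) (L : Fin (n + 1) → ℝ → ℝ), IsRegularGraph n ρ L ∧
      w = (((graphLamHat L (Fin.last n))⁻¹ : ℝ) : EReal) ∧
      v = (((graphLam L (Fin.last n))⁻¹ : ℝ) : EReal)) ∨
    (w = ⊤ ∧ v = if n = 1 then 1 else ⊤)}

/-- The function `ϑₙ` expressing `λ̂ₙ` in terms of `λₙ ∈ [1/n, ∞]` in the regular graph; in the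
degenerate regular graph `λₙ = ∞` one has `λ̂ₙ = λₙ,₂ = 1`. -/
def vartheta (n : ℕ) (l : EReal) : EReal :=
  sSup {v : EReal |
    (∃ (ρ : ℝ) (L : Fin (n + 1) → ℝ → ℝ), IsRegularGraph n ρ L ∧
      l = ((graphLam L 0 : ℝ) : EReal) ∧ v = ((graphLamHat L 0 : ℝ) : EReal)) ∨
    (l = ⊤ ∧ v = 1)}

/-- The Schmidt–Summerer conjecture in dimension `n`: among the vectors that are `ℚ`-linearly
independent together with `1`, the regular graph maximizes `ŵₙ` for given `wₙ`, and `λ̂ₙ` for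
given `λₙ`. -/
def SchmidtSummererConjecture (n : ℕ) : Prop :=
  ∀ ζ : Fin n → ℝ, LinearIndependent ℚ (Fin.cons 1 ζ : Fin (n + 1) → ℝ) →
    wHat ζ ≤ phi n (wOrd ζ) ∧ lamHat ζ ≤ vartheta n (lamOrd ζ)

end UniformApprox

end

namespace UniformApprox

/-! ### The regular graph -/

/-! In the regular graph with ratio ρ one has ŵ = S and w = ρS, where S = 1 + ρ + ⋯ + ρ^(n-1)
(`IsRegularGraph.exponents`). The conjecture therefore says that a large ŵ forces a large ratio w/ŵ.

Resultants give an estimate in the other direction. Let P be irreducible with |P(ζ)| ≤ M(P)^(-ν), M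
the Mahler measure, and choose X so that the solution Q for X satisfies |Q(ζ)| < |P(ζ)|. If
divisibility P ∣ Q would imply |P(ζ)| ≤ |Q(ζ)|, then P ∤ Q, the resultant is a non-zero integer, and
bounding it gives w ≤ ŵ(n-1)/(ŵ-n) (`mul_le_of_irreducible`). So ρ ≤ (n-1)/(ŵ-n), and every c in (n,
ŵ) satisfies c < ∑_{i<n} ((n-1)/(c-n))^i (`lt_geomSum_of_conjecture`). For c = 2n-1-d the sum is
asymptotically n(e^d-1)/d, so this fails for large n once e^d < 1+2d. The critical d is the positive
root δ of e^δ = 1+2δ, and Δ = 1+δ.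

The divisibility condition holds for ŵ* because Q is then irreducible too. It holds for ŵ if w_{n-1}
< w_n, because P can then be taken of degree exactly n. Otherwise small irreducible P exist in lower
degree m, and comparison with Q of smaller Mahler measure gives ŵ_n ≤ m+n-1 (`wHat_le_of_lt_wOrd`):
with m = n-1 this is 2n-2, and with m = n-2 it is 2n-3. -/

theorem eq_of_map_univ_eq {n : ℕ} {f g : Fin n → ℝ} (hf : Monotone f) (hg : Monotone g)
    (h : (Finset.univ : Finset (Fin n)).val.map f = (Finset.univ : Finset (Fin n)).val.map g) :
    f = g := by
  rw [Fin.univ_val_map, Fin.univ_val_map, Multiset.coe_eq_coe] at h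
  exact List.ofFn_injective (h.eq_of_pairwise' (List.sortedLE_ofFn_iff.2 hf).pairwise
    (List.sortedLE_ofFn_iff.2 hg).pairwise)

/-! ### Upper and lower limits of functions invariant under scaling by ρ. -/

section SelfSimilar

variable {f : ℝ → ℝ} {ρ m : ℝ}

theorem selfSimilar_pow (hρ : 1 < ρ) (hf : ∀ q, 0 < q → f (ρ * q) = f q) (k : ℕ) {q : ℝ}
    (hq : 0 < q) : f (ρ ^ k * q) = f q := by
  induction k with
  | zero => simp
  | succ k ih => rw [pow_succ', mul_assoc, hf _ (by positivity), ih]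

theorem exists_mem_Icc_eq (hρ : 1 < ρ) (hf : ∀ q, 0 < q → f (ρ * q) = f q) {q : ℝ} (hq : 1 ≤ q) :
    ∃ r ∈ Set.Icc 1 ρ, f q = f r := by
  obtain ⟨k, h1, h2⟩ := exists_nat_pow_near hq hρ
  have hk : 0 < ρ ^ k := by positivity
  refine ⟨q / ρ ^ k, ⟨(one_le_div hk).2 h1, ?_⟩, ?_⟩
  · rw [div_le_iff₀ hk, ← pow_succ']
    exact h2.le
  · rw [← selfSimilar_pow hρ hf k (q := q / ρ ^ k) (by positivity), mul_div_cancel₀ _ hk.ne']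

theorem frequently_eq_of_selfSimilar (hρ : 1 < ρ) (hf : ∀ q, 0 < q → f (ρ * q) = f q) {q : ℝ}
    (hq : 0 < q) : ∃ᶠ x in atTop, f x = f q :=
  ((tendsto_pow_atTop_atTop_of_one_lt hρ).atTop_mul_const hq).frequently
    (Eventually.of_forall fun k => selfSimilar_pow hρ hf k hq).frequently

variable {M : ℝ}

theorem limsup_of_selfSimilar (hρ : 1 < ρ) (hf : ∀ q, 0 < q → f (ρ * q) = f q)
    (hm : ∀ q ∈ Set.Icc 1 ρ, m ≤ f q) (hM : ∀ q ∈ Set.Icc 1 ρ, f q ≤ M) {q : ℝ} (hq : 0 < q)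
    (hfq : f q = M) : limsup f atTop = M := by
  have h1 : ∀ᶠ x in atTop, m ≤ f x := (eventually_ge_atTop 1).mono fun x hx => by
    obtain ⟨r, hr, h⟩ := exists_mem_Icc_eq hρ hf hx
    exact h ▸ hm r hr
  have h2 : ∀ᶠ x in atTop, f x ≤ M := (eventually_ge_atTop 1).mono fun x hx => by
    obtain ⟨r, hr, h⟩ := exists_mem_Icc_eq hρ hf hx
    exact h ▸ hM r hr
  refine le_antisymm (limsup_le_of_le (IsBoundedUnder.isCoboundedUnder_le ⟨m, h1⟩) h2) ?_
  exact le_limsup_of_frequently_le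
    ((frequently_eq_of_selfSimilar hρ hf hq).mono fun x hx => (hx.trans hfq).ge) ⟨M, h2⟩

theorem liminf_of_selfSimilar (hρ : 1 < ρ) (hf : ∀ q, 0 < q → f (ρ * q) = f q)
    (hm : ∀ q ∈ Set.Icc 1 ρ, m ≤ f q) (hM : ∀ q ∈ Set.Icc 1 ρ, f q ≤ M) {q : ℝ} (hq : 0 < q)
    (hfq : f q = m) : liminf f atTop = m := by
  have h1 : ∀ᶠ x in atTop, m ≤ f x := (eventually_ge_atTop 1).mono fun x hx => by
    obtain ⟨r, hr, h⟩ := exists_mem_Icc_eq hρ hf hx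
    exact h ▸ hm r hr
  have h2 : ∀ᶠ x in atTop, f x ≤ M := (eventually_ge_atTop 1).mono fun x hx => by
    obtain ⟨r, hr, h⟩ := exists_mem_Icc_eq hρ hf hx
    exact h ▸ hM r hr
  refine le_antisymm ?_ (le_liminf_of_le (IsBoundedUnder.isCoboundedUnder_ge ⟨M, h2⟩) h1)
  exact liminf_le_of_frequently_le
    ((frequently_eq_of_selfSimilar hρ hf hq).mono fun x hx => (hx.trans hfq).le) ⟨m, h1⟩

end SelfSimilar

/-! ### The exponents of the regular graph as geometric sums. -/

section RegularGraph

variable {m : ℕ} {ρ : ℝ} {L : Fin (m + 2) → ℝ → ℝ}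

/-- The recursion for the values at the start of a falling period. -/
theorem regularGraph_recursion (hmono : ∀ q, 0 < q → Monotone fun j => L j q)
    (hsim : ∀ q, 0 < q → ∀ j, L j (ρ * q) = ρ * L j q) (hρ : 1 < ρ)
    (hmul : ∀ q ∈ Set.Icc 1 ρ,
      (Finset.univ : Finset (Fin (m + 2))).val.map (fun j => L j q) =
        (L (Fin.last (m + 1)) 1 - (q - 1)) ::ₘ
          (Finset.univ : Finset (Fin (m + 1))).val.map
            (fun j => L j.castSucc 1 + (q - 1) / (m + 1 : ℕ)))
    (h0 : L 0 ρ = L (Fin.last (m + 1)) 1 - (ρ - 1)) (j : Fin (m + 1)) :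
    ρ * L j.succ 1 = L j.castSucc 1 + (ρ - 1) / (m + 1 : ℕ) := by
  have h := hmul ρ ⟨hρ.le, le_rfl⟩
  -- At q = ρ the fallen branch is the lowest one. Cancelling it leaves two increasing families with
  -- equal multisets, which agree term by term.
  rw [← h0, Fin.univ_succ, Finset.cons_val, Multiset.map_cons, Multiset.cons_inj_right,
    Finset.map_val, Multiset.map_map] at h
  have key := eq_of_map_univ_eq ?_ ?_ h
  · have := congrFun key j
    have h2 := hsim 1 one_pos j.succ
    rw [mul_one] at h2
    rw [← h2]
    exact this
  · exact fun a b hab => hmono ρ (by linarith) (Fin.succ_le_succ_iff.2 hab)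
  · intro a b hab
    have := hmono 1 one_pos (Fin.castSucc_le_castSucc_iff.2 hab)
    dsimp only at this ⊢
    linarith

/-- The affine recursion has fixed point 1/n, so the differences Lⱼ(1) - 1/n form a geometric
progression of ratio 1/ρ. -/
theorem regularGraph_start (hrec : ∀ j : Fin (m + 1),
      ρ * L j.succ 1 = L j.castSucc 1 + (ρ - 1) / (m + 1 : ℕ)) (j : Fin (m + 2)) :
    (L j 1 - 1 / (m + 1 : ℕ)) * ρ ^ (j : ℕ) = L 0 1 - 1 / (m + 1 : ℕ) := by
  induction j using Fin.induction with
  | zero => simp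
  | succ j ih =>
    rw [← ih, Fin.val_succ, Fin.val_castSucc, pow_succ']
    linear_combination ρ ^ (j : ℕ) * hrec j

/-- On one period the top function is the maximum of the falling branch and the highest rising one.
Its quotient by q is largest at q = 1, where the fall starts, and smallest where the two branches
cross. -/
theorem regularGraph_exponents (hmono : ∀ q, 0 < q → Monotone fun j => L j q)
    (hsim : ∀ q, 0 < q → ∀ j, L j (ρ * q) = ρ * L j q) (hρ : 1 < ρ)
    (hmul : ∀ q ∈ Set.Icc 1 ρ,
      (Finset.univ : Finset (Fin (m + 2))).val.map (fun j => L j q) =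
        (L (Fin.last (m + 1)) 1 - (q - 1)) ::ₘ
          (Finset.univ : Finset (Fin (m + 1))).val.map
            (fun j => L j.castSucc 1 + (q - 1) / (m + 1 : ℕ)))
    (h0 : L 0 ρ = L (Fin.last (m + 1)) 1 - (ρ - 1)) :
    (graphLamHat L (Fin.last (m + 1)))⁻¹ = ρ * ∑ i ∈ Finset.range (m + 1), ρ ^ i ∧
    (graphLam L (Fin.last (m + 1)))⁻¹ = ∑ i ∈ Finset.range (m + 1), ρ ^ i := by
  have hrec := regularGraph_recursion hmono hsim hρ hmul h0
  have hstart := regularGraph_start hrec (Fin.last (m + 1))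
  have hlast := hrec (Fin.last m)
  have hρ0 : 0 < ρ := by linarith
  rw [← mul_one ρ, hsim 1 one_pos, mul_one] at h0
  rw [Fin.succ_last] at hlast
  rw [Fin.val_last] at hstart
  set S := ∑ i ∈ Finset.range (m + 1), ρ ^ i with hS
  have hSpos : 0 < S := Finset.sum_pos (fun i _ => by positivity) (by simp)
  have hgeom : ρ ^ (m + 1) = (ρ - 1) * S + 1 := by
    rw [hS, mul_comm, geom_sum_mul]; ring
  have htop : ∀ q ∈ Set.Icc 1 ρ, L (Fin.last (m + 1)) q = max (L (Fin.last (m + 1)) 1 - (q - 1))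
      (L (Fin.last m).castSucc 1 + (q - 1) / (m + 1 : ℕ)) := by
    intro q hq
    have hq0 : 0 < q := by linarith [hq.1]
    have hle : ∀ x ∈ (Finset.univ : Finset (Fin (m + 2))).val.map (fun j => L j q),
        x ≤ L (Fin.last (m + 1)) q := by
      intro x hx
      obtain ⟨j, -, rfl⟩ := Multiset.mem_map.1 hx
      exact hmono q hq0 (Fin.le_last j)
    have hmem : L (Fin.last (m + 1)) q ∈
        (Finset.univ : Finset (Fin (m + 2))).val.map (fun j => L j q) :=
      Multiset.mem_map.2 ⟨_, Finset.mem_univ (Fin.last (m + 1)), rfl⟩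
    rw [hmul q hq] at hle hmem
    apply le_antisymm
    · rcases Multiset.mem_cons.1 hmem with h | h
      · exact le_max_of_le_left h.le
      · obtain ⟨j, -, h⟩ := Multiset.mem_map.1 h
        refine le_max_of_le_right (h ▸ ?_)
        have := hmono 1 one_pos (Fin.castSucc_le_castSucc_iff.2 (Fin.le_last j))
        dsimp only at this ⊢
        linarith
    · exact max_le (hle _ (Multiset.mem_cons_self _ _))
        (hle _ (Multiset.mem_cons_of_mem (Multiset.mem_map.2 ⟨Fin.last m, Finset.mem_univ (Fin.last m), rfl⟩)))
  set A := L (Fin.last (m + 1)) 1 with hA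
  set B := L (Fin.last m).castSucc 1 with hB
  clear_value A B
  have hN : (0 : ℝ) < (m + 1 : ℕ) := by positivity
  set N : ℝ := ((m + 1 : ℕ) : ℝ) with hNdef
  clear_value N
  -- the top value at the start of a period
  have hA' : A = (1 + 1 / N) * (ρ * S / (1 + ρ * S)) - 1 := by
    have h1 : (ρ - 1) * ((1 + ρ * S) * (A + 1)) = (ρ - 1) * ((1 + 1 / N) * (ρ * S)) := by
      rw [hgeom] at hstart
      linear_combination ρ * hstart + h0
    have h2 := mul_left_cancel₀ (by linarith : ρ - 1 ≠ 0) h1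
    have h3 : (1 + ρ * S) ≠ 0 := by positivity
    field_simp at h2 ⊢
    linear_combination h2
  -- The crossing point of the two top branches, see `hcross`.
  set q₀ := (ρ + ρ * S) / (1 + ρ * S) with hq₀
  have hden : 0 < 1 + ρ * S := by positivity
  have hq1 : 1 ≤ q₀ := by rw [hq₀, one_le_div hden]; linarith
  have hqρ : q₀ ≤ ρ := by
    rw [hq₀, div_le_iff₀ hden]
    nlinarith [mul_pos hρ0 hSpos, mul_pos (mul_pos hρ0 hSpos) (sub_pos.2 hρ)]
  have hB' : B = 1 / N + (1 + 1 / N) * (-ρ / (1 + ρ * S)) := by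
    have : B = ρ * A - (ρ - 1) / N := by linarith
    rw [this, hA']
    field_simp
    ring
  have hcross : A + 1 - q₀ = B + (q₀ - 1) / N := by
    rw [hA', hB', hq₀]; field_simp; ring
  have hBneg : B - 1 / N < 0 := by
    rw [hB', add_sub_cancel_left, neg_div, mul_neg, neg_lt_zero]
    positivity
  have hA1 : 0 < A + 1 := by rw [hA']; simp only [sub_add_cancel]; positivity
  have hBA : B - 1 / N = ρ * (A - 1 / N) := by linear_combination -hlast
  have hf : ∀ q, 0 < q → L (Fin.last (m + 1)) (ρ * q) / (ρ * q) = L (Fin.last (m + 1)) q / q :=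
    fun q hq => by rw [hsim q hq, mul_div_mul_left _ _ hρ0.ne']
  have hM : ∀ q ∈ Set.Icc 1 ρ, L (Fin.last (m + 1)) q / q ≤ A := by
    intro q hq
    have hq0 : 0 < q := by linarith [hq.1]
    rw [div_le_iff₀ hq0, htop q hq]
    apply max_le
    · nlinarith [hq.1]
    · have : B + (q - 1) / N = q * (1 / N) + (B - 1 / N) := by ring
      rw [this, hBA]
      have : A - 1 / N < 0 := by
        by_contra h
        nlinarith
      nlinarith [hq.2]
  have hm : ∀ q ∈ Set.Icc 1 ρ, (A + 1) / q₀ - 1 ≤ L (Fin.last (m + 1)) q / q := by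
    intro q hq
    have hq0 : 0 < q := by linarith [hq.1]
    rw [htop q hq]
    rcases le_total q q₀ with h | h
    · have h1 : (A - (q - 1)) / q = (A + 1) / q - 1 := by field_simp; ring
      calc (A + 1) / q₀ - 1 ≤ (A + 1) / q - 1 := by gcongr
        _ = (A - (q - 1)) / q := h1.symm
        _ ≤ _ := by gcongr; exact le_max_left _ _
    · have h1 : (B + (q - 1) / N) / q = 1 / N - (1 / N - B) / q := by field_simp; ring
      have h2 : (A + 1) / q₀ - 1 = 1 / N - (1 / N - B) / q₀ := by
        have : A + 1 = q₀ + B + (q₀ - 1) / N := by linarith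
        rw [this]
        have : q₀ ≠ 0 := by linarith
        field_simp
        ring
      have h3 : 0 ≤ 1 / N - B := by linarith
      calc (A + 1) / q₀ - 1 = 1 / N - (1 / N - B) / q₀ := h2
        _ ≤ 1 / N - (1 / N - B) / q := by gcongr
        _ = (B + (q - 1) / N) / q := h1.symm
        _ ≤ _ := by gcongr; exact le_max_right _ _
  have hsup := limsup_of_selfSimilar hρ hf hm hM one_pos (by rw [div_one, hA])
  have hinf := liminf_of_selfSimilar hρ hf hm hM (q := q₀) (by linarith) (by
    rw [htop q₀ ⟨hq1, hqρ⟩, ← hcross, show A - (q₀ - 1) = A + 1 - q₀ by ring, max_self, sub_div,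
      div_self (by linarith)])
  constructor
  · rw [graphLamHat, hsup, hA', ← hNdef]
    field_simp
    ring_nf
    field_simp
    ring
  · rw [graphLam, hinf, hA', hq₀, ← hNdef]
    field_simp
    ring_nf
    field_simp

end RegularGraph

theorem IsRegularGraph.exponents {n : ℕ} (hn : 1 ≤ n) {ρ : ℝ} {L : Fin (n + 1) → ℝ → ℝ}
    (h : IsRegularGraph n ρ L) :
    1 ≤ ρ ∧ (graphLamHat L (Fin.last n))⁻¹ = ρ * ∑ i ∈ Finset.range n, ρ ^ i ∧
      (graphLam L (Fin.last n))⁻¹ = ∑ i ∈ Finset.range n, ρ ^ i := by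
  obtain ⟨m, rfl⟩ : ∃ m, n = m + 1 := ⟨n - 1, by omega⟩
  rcases h with ⟨rfl, h⟩ | ⟨hρ, hmono, hsim, hmul, h0⟩
  · have : L = fun _ _ => 0 := by ext j q; exact h j q
    subst this
    simp only [graphLamHat, graphLam, zero_div, limsup_const, liminf_const, le_refl, one_pow,
      Finset.sum_const, Finset.card_range, nsmul_eq_mul, true_and]
    push_cast
    constructor <;> field_simp <;> ring_nf
  · exact ⟨hρ.le, regularGraph_exponents hmono hsim hρ hmul h0⟩

/-- A number below the supremum is exceeded by the value of some graph, and `w ≠ ⊤` rules out the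
degenerate one. -/
theorem exists_ratio_of_lt_phi {n : ℕ} (hn : 1 ≤ n) {w : EReal} (hw : w ≠ ⊤) {c : ℝ}
    (hc : (c : EReal) < phi n w) :
    ∃ ρ : ℝ, 1 ≤ ρ ∧ w = ((ρ * ∑ i ∈ Finset.range n, ρ ^ i : ℝ) : EReal) ∧
      c < ∑ i ∈ Finset.range n, ρ ^ i := by
  obtain ⟨v, hv, hcv⟩ := lt_sSup_iff.1 hc
  rcases hv with ⟨ρ, L, hL, rfl, rfl⟩ | ⟨h, -⟩
  · obtain ⟨h1, h2, h3⟩ := hL.exponents hn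
    exact ⟨ρ, h1, by rw [h2], by rw [h3] at hcv; exact_mod_cast hcv⟩
  · exact absurd h hw

open Polynomial

/-! ### Resultants and small values of polynomials -/

theorem abs_det_le_of_abs_le_mul {ι : Type*} [Fintype ι] [DecidableEq ι] (A : Matrix ι ι ℝ)
    (r c : ι → ℝ) (h : ∀ i j, |A i j| ≤ r i * c j) :
    |A.det| ≤ (Fintype.card ι).factorial * ((∏ i, r i) * ∏ i, c i) := by
  rw [Matrix.det_apply]
  refine (Finset.abs_sum_le_sum_abs _ _).trans ?_
  rw [← Fintype.card_perm, ← nsmul_eq_mul]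
  refine Finset.sum_le_card_nsmul _ _ _ fun σ _ => ?_
  have h1 : |Equiv.Perm.sign σ • ∏ i, A (σ i) i| = ∏ i, |A (σ i) i| := by
    rcases Int.units_eq_one_or (Equiv.Perm.sign σ) with hs | hs <;>
      simp [hs, Finset.abs_prod]
  rw [h1, ← Equiv.prod_comp σ r, ← Finset.prod_mul_distrib]
  exact Finset.prod_le_prod (fun _ _ => abs_nonneg _) fun i _ => h _ _

theorem sum_shifted_coeff (f : ℝ[X]) (ζ : ℝ) {d j N : ℕ} (hf : f.natDegree ≤ d)
    (hN : j + d < N) :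
    ∑ i : Fin N, ζ ^ (i : ℕ) *
      (if (i : ℕ) ∈ Set.Icc j (j + d) then f.coeff (i - j) else 0) = ζ ^ j * f.eval ζ := by
  rw [Fin.sum_univ_eq_sum_range (fun i => ζ ^ i *
      (if i ∈ Set.Icc j (j + d) then f.coeff (i - j) else 0)) N,
    eval_eq_sum_range' (Nat.lt_succ_of_le hf), Finset.mul_sum]
  symm
  have hinj : Set.InjOn (fun i => j + i) (Finset.range (d + 1) : Set ℕ) :=
    fun a _ b _ h => by simpa using h
  rw [← Finset.sum_subset (s₂ := Finset.range N) (s₁ := (Finset.range (d + 1)).image fun i => j + i),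
    Finset.sum_image hinj]
  · refine Finset.sum_congr rfl fun i hi => ?_
    have : i ≤ d := by simpa [Nat.lt_succ_iff] using hi
    rw [if_pos ⟨by omega, by omega⟩, Nat.add_sub_cancel_left, pow_add]
    ring
  · intro i hi
    obtain ⟨k, hk, rfl⟩ := Finset.mem_image.1 hi
    have : k < d + 1 := by simpa using hk
    simp only [Finset.mem_range]
    omega
  · intro i _ hi
    rw [if_neg, mul_zero]
    rintro ⟨h1, h2⟩
    exact hi (Finset.mem_image.2 ⟨i - j, by simp only [Finset.mem_range]; omega, by omega⟩)

/-- The resultant is bounded in terms of the values of the two polynomials at a point. -/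
theorem abs_resultant_le {f g : ℝ[X]} (hf : 1 ≤ f.natDegree) {a b : ℝ} (ha : 0 < a) (hb : 0 < b)
    (hfa : ∀ i, |f.coeff i| ≤ a) (hgb : ∀ i, |g.coeff i| ≤ b) (ζ : ℝ) :
    |resultant f g| ≤ (f.natDegree + g.natDegree).factorial *
      (max 1 |ζ| ^ (f.natDegree + g.natDegree) * (|f.eval ζ| / a + |g.eval ζ| / b) *
        (b ^ f.natDegree * a ^ g.natDegree)) := by
  set m := f.natDegree with hm
  set n := g.natDegree with hn
  set T := max 1 |ζ| ^ (m + n) * (|f.eval ζ| / a + |g.eval ζ| / b) with hT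
  have hT0 : 0 ≤ T := by positivity
  let z : Fin (m + n) := ⟨0, by omega⟩
  let A := sylvester f g m n
  -- Row 0 enters the combination with coefficient ζ^0 = 1, so the determinant is unchanged. The new
  -- row consists of ζ^j g(ζ) and ζ^j f(ζ), which makes the determinant small when both values are.
  have hdet : (A.updateRow z (∑ i : Fin (m + n), ζ ^ (i : ℕ) • A i)).det = resultant f g := by
    rw [Matrix.det_updateRow_sum]
    simp only [z, pow_zero, one_smul]
    rfl
  let c : Fin (m + n) → ℝ := Fin.addCases (fun _ => b) (fun _ => a)
  have hc : ∏ i, c i = b ^ m * a ^ n := by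
    simp [c, Fin.prod_univ_add]
  have hr : ∏ i, (if i = z then T else 1) = T := by simp
  rw [← hdet]
  have key := abs_det_le_of_abs_le_mul (A.updateRow z (∑ i : Fin (m + n), ζ ^ (i : ℕ) • A i))
    (fun i => if i = z then T else 1) c ?_
  · rwa [hr, hc, Fintype.card_fin] at key
  have hpow : ∀ j ≤ m + n, |ζ ^ j| ≤ max 1 |ζ| ^ (m + n) := fun j hj => by
    rw [abs_pow]
    exact (pow_le_pow_left₀ (abs_nonneg _) (le_max_right _ _) _).trans
      (pow_le_pow_right₀ (le_max_left _ _) hj)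
  intro i j
  by_cases hi : i = z
  · subst hi
    rw [Matrix.updateRow_self, if_pos rfl, Finset.sum_apply]
    simp only [Pi.smul_apply, smul_eq_mul]
    induction j using Fin.addCases with
    | left j =>
      have := sum_shifted_coeff g ζ (d := n) (j := j) (N := m + n) le_rfl (by omega)
      simp only [A, c, sylvester, Matrix.of_apply, Fin.addCases_left]
      rw [this, abs_mul, hT]
      calc |ζ ^ (j : ℕ)| * |g.eval ζ| ≤ max 1 |ζ| ^ (m + n) * |g.eval ζ| := by
            gcongr
            exact hpow _ (by omega)
        _ = max 1 |ζ| ^ (m + n) * (0 + |g.eval ζ| / b) * b := by field_simp; ring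
        _ ≤ _ := by gcongr; positivity
    | right j =>
      have := sum_shifted_coeff f ζ (d := m) (j := j) (N := m + n) le_rfl (by omega)
      simp only [A, c, sylvester, Matrix.of_apply, Fin.addCases_right]
      rw [this, abs_mul, hT]
      calc |ζ ^ (j : ℕ)| * |f.eval ζ| ≤ max 1 |ζ| ^ (m + n) * |f.eval ζ| := by
            gcongr
            exact hpow _ (by omega)
        _ = max 1 |ζ| ^ (m + n) * (|f.eval ζ| / a + 0) * a := by field_simp; ring
        _ ≤ _ := by gcongr; positivity
  · rw [Matrix.updateRow_ne hi, if_neg hi, one_mul]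
    induction j using Fin.addCases with
    | left j =>
      simp only [A, c, sylvester, Matrix.of_apply, Fin.addCases_left]
      split_ifs
      · exact hgb _
      · simpa using hb.le
    | right j =>
      simp only [A, c, sylvester, Matrix.of_apply, Fin.addCases_right]
      split_ifs
      · exact hfa _
      · simpa using ha.le

/-- By Gauss's lemma P stays irreducible over ℚ and P ∤ Q there, so P and Q are coprime over ℚ. -/
theorem resultant_ne_zero_of_not_dvd {P Q : ℤ[X]} (hP : Irreducible P) (hdeg : P.natDegree ≠ 0)
    (hPQ : ¬ P ∣ Q) : resultant P Q ≠ 0 := by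
  have hprim := hP.isPrimitive hdeg
  have hirr : Irreducible (P.map (algebraMap ℤ ℚ)) :=
    hprim.irreducible_iff_irreducible_map_fraction_map.1 hP
  have hcop : IsCoprime (P.map (algebraMap ℤ ℚ)) (Q.map (algebraMap ℤ ℚ)) := by
    rcases EuclideanDomain.dvd_or_coprime _ _ hirr with h | h
    · exact absurd (hprim.dvd_of_fraction_map_dvd_fraction_map h) hPQ
    · exact h
  have h := resultant_ne_zero _ _ hcop
  have hinj : Function.Injective (algebraMap ℤ ℚ) := FaithfulSMul.algebraMap_injective ℤ ℚ
  rw [natDegree_map_eq_of_injective hinj, natDegree_map_eq_of_injective hinj,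
    resultant_map_map] at h
  exact fun h0 => h (by rw [h0, map_zero])

/-- A non-zero integer resultant has modulus at least 1. As a, b ≥ 1, the actual degrees can be
replaced by their bounds m and n. -/
theorem one_le_of_not_dvd (m n : ℕ) (ζ : ℝ) : ∃ C : ℝ, 0 < C ∧ ∀ P Q : ℤ[X], Irreducible P →
    1 ≤ P.natDegree → P.natDegree ≤ m → Q.natDegree ≤ n → ¬ P ∣ Q → ∀ a b : ℝ, 1 ≤ a → 1 ≤ b →
    (∀ i, |(P.coeff i : ℝ)| ≤ a) → (∀ i, |(Q.coeff i : ℝ)| ≤ b) →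
    1 ≤ C * (a ^ n * b ^ m * (|aeval ζ P| / a + |aeval ζ Q| / b)) := by
  refine ⟨(m + n).factorial * max 1 |ζ| ^ (m + n), by positivity, ?_⟩
  intro P Q hP h1 hm hn hPQ a b ha hb hPa hQb
  have h := resultant_ne_zero_of_not_dvd hP (by omega) hPQ
  have hinj : Function.Injective (Int.castRingHom ℝ) := RingHom.injective_int _
  have key := abs_resultant_le (f := P.map (Int.castRingHom ℝ)) (g := Q.map (Int.castRingHom ℝ))
    (a := a) (b := b) (by rwa [natDegree_map_eq_of_injective hinj]) (by linarith) (by linarith)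
    (by simpa using hPa) (by simpa using hQb) ζ
  rw [natDegree_map_eq_of_injective hinj, natDegree_map_eq_of_injective hinj, resultant_map_map]
    at key
  have hint : (1 : ℝ) ≤ |Int.castRingHom ℝ (resultant P Q)| := by
    rw [eq_intCast, ← Int.cast_abs]
    exact_mod_cast Int.one_le_abs h
  have heP : eval ζ (P.map (Int.castRingHom ℝ)) = aeval ζ P := by
    rw [eval_map, aeval_def]; rfl
  have heQ : eval ζ (Q.map (Int.castRingHom ℝ)) = aeval ζ Q := by
    rw [eval_map, aeval_def]; rfl
  rw [heP, heQ] at key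
  have ha0 : 0 < a := by linarith
  have hb0 : 0 < b := by linarith
  have hfac : ((P.natDegree + Q.natDegree).factorial : ℝ) ≤ (m + n).factorial := by
    exact_mod_cast Nat.factorial_le (by omega)
  calc (1 : ℝ) ≤ _ := hint
    _ ≤ _ := key
    _ ≤ (m + n).factorial * (max 1 |ζ| ^ (m + n) * (|aeval ζ P| / a + |aeval ζ Q| / b) *
          (b ^ m * a ^ n)) := by
        gcongr
        · exact le_max_left _ _
    _ = _ := by ring

/-! ### Mahler measure of integer polynomials -/

/-- The Mahler measure of an integer polynomial. -/
noncomputable def intMahler (P : ℤ[X]) : ℝ := (P.map (Int.castRingHom ℂ)).mahlerMeasure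

theorem intMahler_mul (P Q : ℤ[X]) : intMahler (P * Q) = intMahler P * intMahler Q := by
  rw [intMahler, Polynomial.map_mul, mahlerMeasure_mul]; rfl

theorem one_le_intMahler {P : ℤ[X]} (hP : P ≠ 0) : 1 ≤ intMahler P :=
  one_le_mahlerMeasure_of_ne_zero hP

theorem intMahler_C (a : ℤ) : intMahler (C a) = |(a : ℝ)| := by
  rw [intMahler, Polynomial.map_C, mahlerMeasure_const, eq_intCast, Complex.norm_intCast]

/-- This exact monotonicity and multiplicativity are the reason to measure polynomials by Mahler
measure; it differs from the height only by constant factors depending on the degree bound. -/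
theorem intMahler_le_of_dvd {P Q : ℤ[X]} (hQ : Q ≠ 0) (h : P ∣ Q) :
    intMahler P ≤ intMahler Q := by
  obtain ⟨R, rfl⟩ := h
  rw [intMahler_mul]
  exact le_mul_of_one_le_right (zero_le_one.trans (one_le_intMahler (left_ne_zero_of_mul hQ)))
    (one_le_intMahler (right_ne_zero_of_mul hQ))

theorem abs_coeff_le_intMahler {P : ℤ[X]} {n : ℕ} (hP : P ≠ 0) (hn : P.natDegree ≤ n) (i : ℕ) :
    |(P.coeff i : ℝ)| ≤ 2 ^ n * intMahler P := by
  have h := norm_coeff_le_choose_mul_mahlerMeasure i (P.map (Int.castRingHom ℂ))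
  rw [natDegree_map_eq_of_injective (RingHom.injective_int _), coeff_map, eq_intCast,
    Complex.norm_intCast] at h
  refine h.trans ?_
  have h1 : (P.natDegree.choose i : ℝ) ≤ 2 ^ n := by
    exact_mod_cast (Nat.choose_le_two_pow _ _).trans (Nat.pow_le_pow_right two_pos hn)
  exact mul_le_mul_of_nonneg_right h1 (zero_le_one.trans (one_le_intMahler hP))

theorem intMahler_le {P : ℤ[X]} {n : ℕ} (hn : P.natDegree ≤ n) {B : ℝ}
    (hB : ∀ i, |(P.coeff i : ℝ)| ≤ B) : intMahler P ≤ (n + 1) * B := by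
  refine (mahlerMeasure_le_sum_norm_coeff _).trans ?_
  rw [sum_over_range' _ (by simp) (n + 1)
    (by rw [natDegree_map_eq_of_injective (RingHom.injective_int _)]; omega)]
  refine (Finset.sum_le_card_nsmul _ _ B fun i _ => ?_).trans (by simp)
  rw [coeff_map, eq_intCast, Complex.norm_intCast]
  exact hB i

theorem finite_intMahler_le (n : ℕ) (B : ℝ) :
    {P : ℤ[X] | P.natDegree ≤ n ∧ intMahler P ≤ B}.Finite := by
  refine (finite_mahlerMeasure_le n B.toNNReal).subset fun P hP => ⟨hP.1, hP.2.trans ?_⟩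
  exact Real.le_coe_toNNReal B

theorem aeval_ne_zero_of_transcendental {ζ : ℝ} (hζ : Transcendental ℚ ζ) {P : ℤ[X]} (hP : P ≠ 0) :
    aeval ζ P ≠ 0 := by
  intro h
  exact hζ ((IsFractionRing.isAlgebraic_iff ℤ ℚ ℝ).1 ⟨P, hP, h⟩)

/-! ### Exponents in terms of integer polynomials -/

/-- `Q` is a non-zero integer polynomial of degree at most `n` with coefficients bounded by `X` and
`|Q(ζ)| ≤ X ^ (-ν)`. -/
def IsPolySolution (n : ℕ) (ζ X ν : ℝ) (Q : ℤ[X]) : Prop :=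
  Q ≠ 0 ∧ Q.natDegree ≤ n ∧ (∀ i, |(Q.coeff i : ℝ)| ≤ X) ∧ |aeval ζ Q| ≤ X ^ (-ν)

theorem aeval_eq_linForm {n : ℕ} (ζ : ℝ) {Q : ℤ[X]} (hQ : Q.natDegree ≤ n) :
    aeval ζ Q = (Q.coeff 0 : ℝ) + ∑ i : Fin n, powers n ζ i * (Q.coeff (i + 1) : ℝ) := by
  rw [aeval_eq_sum_range' (Nat.lt_succ_of_le hQ), Finset.sum_range_succ', add_comm,
    ← Fin.sum_univ_eq_sum_range (fun i => Q.coeff (i + 1) • ζ ^ (i + 1)) n]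
  simp [powers, mul_comm]

theorem exists_isLinFormSolution_iff {n : ℕ} {ζ X ν : ℝ} :
    (∃ x y, IsLinFormSolution (powers n ζ) X ν x y) ↔ ∃ Q, IsPolySolution n ζ X ν Q := by
  constructor
  · rintro ⟨x, y, hne, hx, hy, h⟩
    set v : Fin (n + 1) → ℤ := Fin.cons x y
    have h0 : (ofFn (n + 1) v).coeff 0 = x := ofFn_coeff_eq_val_of_lt v n.succ_pos
    have hs : ∀ i : Fin n, (ofFn (n + 1) v).coeff (i + 1) = y i := fun i =>
      ofFn_coeff_eq_val_of_lt v (Nat.succ_lt_succ i.2)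
    have hdeg : (ofFn (n + 1) v).natDegree ≤ n := Nat.le_of_lt_succ (ofFn_natDegree_lt (by omega) v)
    refine ⟨ofFn (n + 1) v, ?_, hdeg, ?_, ?_⟩
    · intro hzero
      rw [hzero] at h0 hs
      rcases hne with hne | hne
      · exact hne h0.symm
      · exact hne (funext fun i => (hs i).symm)
    · intro i
      rcases lt_or_ge i (n + 1) with hi | hi
      · rcases i with _ | i
        · rwa [h0]
        · have := hs ⟨i, by omega⟩
          rw [this]
          exact hy _
      · rw [ofFn_coeff_eq_zero_of_ge _ hi, Int.cast_zero, abs_zero]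
        exact (abs_nonneg _).trans hx
    · rw [aeval_eq_linForm ζ hdeg, h0]
      simpa only [hs] using h
  · rintro ⟨Q, hne, hdeg, hc, h⟩
    refine ⟨Q.coeff 0, fun i => Q.coeff (i + 1), ?_, hc 0, fun i => hc _, ?_⟩
    · by_contra! hzero
      apply hne
      ext i
      rcases i with _ | i
      · exact hzero.1
      · rcases lt_or_ge i n with hi | hi
        · exact congrFun hzero.2 ⟨i, hi⟩
        · rw [coeff_eq_zero_of_natDegree_lt (by omega), coeff_zero]
    · rwa [← aeval_eq_linForm ζ hdeg]

theorem wOrd_powers (n : ℕ) (ζ : ℝ) :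
    wOrd (powers n ζ) = sSup ((fun ν : ℝ => (ν : EReal)) ''
      {ν : ℝ | ∃ᶠ X : ℝ in atTop, ∃ Q, IsPolySolution n ζ X ν Q}) := by
  simp only [wOrd, exists_isLinFormSolution_iff]

theorem wHat_powers (n : ℕ) (ζ : ℝ) :
    wHat (powers n ζ) = sSup ((fun ν : ℝ => (ν : EReal)) ''
      {ν : ℝ | ∀ᶠ X : ℝ in atTop, ∃ Q, IsPolySolution n ζ X ν Q}) := by
  simp only [wHat, exists_isLinFormSolution_iff]

theorem lt_sSup_coe_image {s : Set ℝ} {a : EReal}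
    (h : a < sSup ((fun ν : ℝ => (ν : EReal)) '' s)) : ∃ ν ∈ s, a < (ν : EReal) := by
  obtain ⟨_, ⟨ν, hν, rfl⟩, h⟩ := lt_sSup_iff.1 h
  exact ⟨ν, hν, h⟩

theorem IsPolySolution.of_le {n : ℕ} {ζ X ν μ : ℝ} {Q : ℤ[X]} (h : IsPolySolution n ζ X ν Q)
    (hμ : μ ≤ ν) (hX : 1 ≤ X) : IsPolySolution n ζ X μ Q :=
  ⟨h.1, h.2.1, h.2.2.1, h.2.2.2.trans (Real.rpow_le_rpow_of_exponent_le hX (by linarith))⟩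

theorem IsPolySolution.mono {m n : ℕ} {ζ X ν : ℝ} {Q : ℤ[X]} (h : IsPolySolution m ζ X ν Q)
    (hmn : m ≤ n) : IsPolySolution n ζ X ν Q :=
  ⟨h.1, h.2.1.trans hmn, h.2.2⟩

theorem frequently_of_lt_wOrd {n : ℕ} {ζ ν : ℝ} (h : (ν : EReal) < wOrd (powers n ζ)) :
    ∃ᶠ X : ℝ in atTop, ∃ Q, IsPolySolution n ζ X ν Q := by
  rw [wOrd_powers] at h
  obtain ⟨ν', hν', hlt⟩ := lt_sSup_coe_image h
  have hlt' : ν < ν' := by exact_mod_cast hlt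
  exact (Frequently.and_eventually hν' (eventually_ge_atTop 1)).mono fun X hX =>
    hX.1.imp fun Q hQ => hQ.of_le hlt'.le hX.2

theorem eventually_of_lt_wHat {n : ℕ} {ζ ν : ℝ} (h : (ν : EReal) < wHat (powers n ζ)) :
    ∀ᶠ X : ℝ in atTop, ∃ Q, IsPolySolution n ζ X ν Q := by
  rw [wHat_powers] at h
  obtain ⟨ν', hν', hlt⟩ := lt_sSup_coe_image h
  have hlt' : ν < ν' := by exact_mod_cast hlt
  exact (Eventually.and hν' (eventually_ge_atTop 1)).mono fun X hX =>
    hX.1.imp fun Q hQ => hQ.of_le hlt'.le hX.2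

theorem eventually_not_of_wOrd_lt {n : ℕ} {ζ ν : ℝ} (h : wOrd (powers n ζ) < (ν : EReal)) :
    ∀ᶠ X : ℝ in atTop, ∀ Q, ¬ IsPolySolution n ζ X ν Q := by
  by_contra hcon
  refine absurd h (not_lt.2 ?_)
  rw [wOrd_powers]
  refine le_sSup ⟨ν, ?_, rfl⟩
  simpa [Filter.Frequently] using hcon

theorem wOrd_powers_mono {m n : ℕ} (hmn : m ≤ n) (ζ : ℝ) :
    wOrd (powers m ζ) ≤ wOrd (powers n ζ) := by
  rw [wOrd_powers, wOrd_powers]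
  exact sSup_le_sSup (Set.image_mono fun ν hν =>
    Frequently.mono hν fun X => Exists.imp fun Q hQ => hQ.mono hmn)

theorem wHat_le_wOrd {n : ℕ} (ζ : Fin n → ℝ) : wHat ζ ≤ wOrd ζ :=
  sSup_le_sSup (Set.image_mono fun _ hν => Eventually.frequently hν)

/-! ### Approximation by algebraic numbers and by irreducible polynomials -/

theorem exists_abs_aeval_le (n : ℕ) (ζ : ℝ) : ∃ C : ℝ, 0 < C ∧ ∀ P : ℤ[X], P.natDegree ≤ n →
    ∀ α : ℝ, aeval α P = 0 → |ζ - α| ≤ 1 → |aeval ζ P| ≤ C * (P.supNorm * |ζ - α|) := by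
  set R := |ζ| + 1 with hR
  refine ⟨1 + ∑ i ∈ Finset.range (n + 1), i * R ^ (i - 1), by positivity, ?_⟩
  intro P hn α hα hdist
  have hζR : |ζ| ≤ R := by rw [hR]; linarith
  have hαR : |α| ≤ R := by
    have := abs_sub_abs_le_abs_sub α ζ
    rw [abs_sub_comm] at this
    rw [hR]; linarith
  have hpow : ∀ i : ℕ, |ζ ^ i - α ^ i| ≤ |ζ - α| * (i * R ^ (i - 1)) := by
    intro i
    have h := abs_pow_sub_pow_le ζ α i
    calc _ ≤ _ := h
      _ ≤ |ζ - α| * i * R ^ (i - 1) := by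
        gcongr
        exact max_le hζR hαR
      _ = _ := by ring
  have hP0 : 0 ≤ P.supNorm := P.supNorm_nonneg
  calc |aeval ζ P| = |aeval ζ P - aeval α P| := by rw [hα, sub_zero]
    _ = |∑ i ∈ Finset.range (n + 1), (P.coeff i : ℝ) * (ζ ^ i - α ^ i)| := by
      rw [aeval_eq_sum_range' (Nat.lt_succ_of_le hn), aeval_eq_sum_range' (Nat.lt_succ_of_le hn),
        ← Finset.sum_sub_distrib]
      simp [mul_sub]
    _ ≤ ∑ i ∈ Finset.range (n + 1), |(P.coeff i : ℝ) * (ζ ^ i - α ^ i)| :=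
      Finset.abs_sum_le_sum_abs _ _
    _ ≤ ∑ i ∈ Finset.range (n + 1), P.supNorm * (|ζ - α| * (i * R ^ (i - 1))) := by
      refine Finset.sum_le_sum fun i _ => ?_
      rw [abs_mul]
      refine mul_le_mul ?_ (hpow i) (abs_nonneg _) hP0
      simpa [Int.norm_eq_abs] using P.le_supNorm i
    _ = (∑ i ∈ Finset.range (n + 1), (i : ℝ) * R ^ (i - 1)) * (P.supNorm * |ζ - α|) := by
      rw [Finset.sum_mul]
      exact Finset.sum_congr rfl fun i _ => by ring
    _ ≤ _ := by gcongr; linarith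

/-- The minimal polynomial of a good approximation α is small at ζ, since |P(ζ)| is at most a
constant times H(α)|ζ - α|. The constant is absorbed by lowering the exponent slightly. -/
theorem eventually_irreducible_of_lt_wStarHat {n : ℕ} {ζ ν : ℝ} (hν : 0 ≤ ν)
    (h : (ν : EReal) < wStarHat n ζ) :
    ∀ᶠ X : ℝ in atTop, ∃ Q, IsPolySolution n ζ X ν Q ∧ Irreducible Q := by
  obtain ⟨ν', hν', hlt⟩ := lt_sSup_coe_image h
  have hlt' : ν < ν' := by exact_mod_cast hlt
  obtain ⟨C, hC, hbound⟩ := exists_abs_aeval_le n ζ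
  have hlarge : ∀ᶠ X : ℝ in atTop, C ≤ X ^ (ν' - ν) :=
    (tendsto_rpow_atTop (by linarith)).eventually_ge_atTop C
  filter_upwards [hν', hlarge, eventually_ge_atTop 1] with X hX hXC hX1
  obtain ⟨α, P, ⟨hirr, hroot⟩, hdeg, hH, -, hdist⟩ := hX
  have hX0 : 0 < X := by linarith
  have hne : P ≠ 0 := hirr.ne_zero
  have hH1 : 1 ≤ P.supNorm := by
    have h1 := P.le_supNorm P.natDegree
    have h2 : (1 : ℝ) ≤ ‖P.coeff P.natDegree‖ := by
      rw [Int.norm_eq_abs]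
      exact_mod_cast Int.one_le_abs (leadingCoeff_ne_zero.2 hne)
    linarith
  have hpos : 0 < P.supNorm := by linarith
  have hle1 : |ζ - α| ≤ 1 := by
    refine hdist.trans (mul_le_one₀ (inv_le_one_of_one_le₀ hH1) (by positivity) ?_)
    exact Real.rpow_le_one_of_one_le_of_nonpos hX1 (by linarith)
  refine ⟨P, ⟨hne, hdeg, fun i => ?_, ?_⟩, hirr⟩
  · refine le_trans ?_ hH
    simpa [Int.norm_eq_abs] using P.le_supNorm i
  · calc |aeval ζ P| ≤ C * (P.supNorm * |ζ - α|) := hbound P hdeg α hroot hle1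
      _ ≤ C * (P.supNorm * (P.supNorm⁻¹ * X ^ (-ν'))) := by gcongr
      _ = C * X ^ (-ν') := by field_simp
      _ ≤ X ^ (ν' - ν) * X ^ (-ν') := by gcongr
      _ = X ^ (-ν) := by rw [← Real.rpow_add hX0]; ring_nf

/-! ### Passing from small polynomials to small irreducible polynomials. -/

/-- The values at `ζ` of integer polynomials of degree at most `k` are bounded from below by a
multiple of the `-ν`-th power of the Mahler measure. -/
def HasLowerBound (k : ℕ) (ζ ν : ℝ) : Prop :=
  ∃ κ : ℝ, 0 < κ ∧ ∀ P : ℤ[X], P ≠ 0 → P.natDegree ≤ k → κ * intMahler P ^ (-ν) ≤ |aeval ζ P|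

theorem rpow_neg_le_one_of_one_le {x ν : ℝ} (hx : 1 ≤ x) (hν : 0 ≤ ν) : x ^ (-ν) ≤ 1 :=
  Real.rpow_le_one_of_one_le_of_nonpos hx (by linarith)

theorem intMahler_rpow_le_of_natDegree_eq_zero (ζ : ℝ) {ν : ℝ} (hν : 0 ≤ ν) {P : ℤ[X]} (hP : P ≠ 0)
    (hdeg : P.natDegree = 0) : intMahler P ^ (-ν) ≤ |aeval ζ P| := by
  obtain ⟨a, rfl⟩ : ∃ a, P = C a := ⟨_, eq_C_of_natDegree_eq_zero hdeg⟩
  have h1 := one_le_intMahler hP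
  refine (rpow_neg_le_one_of_one_le h1 hν).trans ?_
  rw [intMahler_C] at h1
  simpa using h1

theorem hasLowerBound_zero (ζ : ℝ) {ν : ℝ} (hν : 0 ≤ ν) : HasLowerBound 0 ζ ν :=
  ⟨1, one_pos, fun P hP hdeg => by
    rw [one_mul]
    exact intMahler_rpow_le_of_natDegree_eq_zero ζ hν hP (Nat.le_zero.1 hdeg)⟩

theorem hasLowerBound_of_wOrd_lt {k : ℕ} {ζ ν : ℝ}
    (h : wOrd (powers k ζ) < (ν : EReal)) : HasLowerBound k ζ ν := by
  obtain ⟨X₀, hX₀⟩ := eventually_atTop.1 (eventually_not_of_wOrd_lt h)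
  set B := max 1 X₀ * 2 ^ k with hB
  have hB0 : 0 < B := by positivity
  refine ⟨B ^ (-ν), by positivity, fun P hP hdeg => ?_⟩
  have hM := one_le_intMahler hP
  rw [← Real.mul_rpow hB0.le (by linarith)]
  by_contra! hlt
  have h2 : (1 : ℝ) ≤ 2 ^ k := one_le_pow₀ one_le_two
  refine hX₀ (B * intMahler P) ?_ P ⟨hP, hdeg, fun i => ?_, hlt.le⟩
  · calc X₀ ≤ max 1 X₀ := le_max_right _ _
      _ ≤ B := le_mul_of_one_le_right (by positivity) h2
      _ ≤ B * intMahler P := le_mul_of_one_le_right hB0.le hM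
  · refine (abs_coeff_le_intMahler hP hdeg i).trans ?_
    gcongr
    rw [hB]
    exact le_mul_of_one_le_left (by positivity) (le_max_left _ _)

/-- Both sides are multiplicative up to the constant. Each non-constant factor costs one κ and
constant factors cost none, so κ to the degree suffices. -/
theorem lower_bound_of_irreducible {n : ℕ} {ζ ν κ : ℝ} (hν : 0 ≤ ν) (hκ : 0 < κ) (hκ1 : κ ≤ 1)
    (h : ∀ P : ℤ[X], Irreducible P → 1 ≤ P.natDegree → P.natDegree ≤ n →
      κ * intMahler P ^ (-ν) ≤ |aeval ζ P|) (Q : ℤ[X]) :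
    Q ≠ 0 → Q.natDegree ≤ n → κ ^ Q.natDegree * intMahler Q ^ (-ν) ≤ |aeval ζ Q| := by
  induction Q using WfDvdMonoid.induction_on_irreducible with
  | zero => exact fun h => absurd rfl h
  | unit u hu =>
    intro hne _
    rw [natDegree_eq_zero_of_isUnit hu, pow_zero]
    rw [one_mul]
    exact intMahler_rpow_le_of_natDegree_eq_zero ζ hν hne (natDegree_eq_zero_of_isUnit hu)
  | mul a i ha hi ih =>
    intro hne hdeg
    rw [natDegree_mul hi.ne_zero ha] at hdeg ⊢
    have h1 := ih ha (by omega)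
    have hMi := one_le_intMahler hi.ne_zero
    have hMa := one_le_intMahler ha
    have h2 : κ ^ i.natDegree * intMahler i ^ (-ν) ≤ |aeval ζ i| := by
      rcases Nat.eq_zero_or_pos i.natDegree with h0 | h0
      · rw [h0, pow_zero, one_mul]
        exact intMahler_rpow_le_of_natDegree_eq_zero ζ hν hi.ne_zero h0
      · refine le_trans ?_ (h i hi h0 (by omega))
        gcongr
        exact pow_le_of_le_one hκ.le hκ1 (by omega)
    rw [intMahler_mul, Real.mul_rpow (by linarith) (by linarith), map_mul, abs_mul, pow_add]
    calc κ ^ i.natDegree * κ ^ a.natDegree * (intMahler i ^ (-ν) * intMahler a ^ (-ν))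
        = (κ ^ i.natDegree * intMahler i ^ (-ν)) * (κ ^ a.natDegree * intMahler a ^ (-ν)) := by ring
      _ ≤ _ := by gcongr

/-- If there were no such P, all irreducible polynomials of degree at most n would satisfy a uniform
lower bound with exponent ν: degrees up to k by hypothesis, and Mahler measure below `B` by
finiteness and transcendence. The bound would pass to all products and contradict ν < wₙ. With k = n
- 1 the degree of P is exactly n. -/
theorem exists_irreducible {n k : ℕ} {ζ ν : ℝ} (hζ : Transcendental ℚ ζ) (hν : 0 ≤ ν)
    (h : (ν : EReal) < wOrd (powers n ζ)) (hk : HasLowerBound k ζ ν) (B : ℝ) :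
    ∃ P : ℤ[X], Irreducible P ∧ k < P.natDegree ∧ P.natDegree ≤ n ∧ B ≤ intMahler P ∧
      |aeval ζ P| ≤ intMahler P ^ (-ν) := by
  by_contra! hcon
  obtain ⟨κ₀, hκ₀, hbad⟩ := hk
  obtain ⟨κ₁, hκ₁, hfin⟩ : ∃ κ₁ : ℝ, 0 < κ₁ ∧ ∀ P : ℤ[X], P ≠ 0 → P.natDegree ≤ n →
      intMahler P ≤ B → κ₁ ≤ |aeval ζ P| := by
    have hf := ((finite_intMahler_le n B).inter_of_left {P | P ≠ 0}).image fun P => |aeval ζ P|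
    rcases (((fun P => |aeval ζ P|) '' ({P : ℤ[X] | P.natDegree ≤ n ∧ intMahler P ≤ B} ∩
      {P | P ≠ 0})).eq_empty_or_nonempty) with he | hne
    · refine ⟨1, one_pos, fun P h1 h2 h3 => ?_⟩
      have : |aeval ζ P| ∈ (∅ : Set ℝ) := he ▸ ⟨P, ⟨⟨h2, h3⟩, h1⟩, rfl⟩
      exact absurd this (Set.notMem_empty _)
    · obtain ⟨_, ⟨P₀, hP₀, rfl⟩, hmin⟩ := hf.exists_minimal hne
      refine ⟨|aeval ζ P₀|, abs_pos.2 (aeval_ne_zero_of_transcendental hζ hP₀.2),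
        fun P h1 h2 h3 => ?_⟩
      by_contra! hlt
      exact absurd (hmin ⟨P, ⟨⟨h2, h3⟩, h1⟩, rfl⟩ hlt.le) (not_le.2 hlt)
  set κ := min κ₀ (min κ₁ 1) with hκdef
  have hκ : 0 < κ := by positivity
  have hκ1 : κ ≤ 1 := (min_le_right _ _).trans (min_le_right _ _)
  have hlow := lower_bound_of_irreducible (n := n) (ζ := ζ) hν hκ hκ1 (fun P hP h1 hn => by
    have hM := one_le_intMahler hP.ne_zero
    rcases le_or_gt P.natDegree k with hPk | hPk
    · refine le_trans ?_ (hbad P hP.ne_zero hPk)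
      gcongr
      exact min_le_left _ _
    · rcases le_or_gt B (intMahler P) with hB | hB
      · refine le_trans ?_ (hcon P hP hPk hn hB).le
        exact mul_le_of_le_one_left (by positivity) hκ1
      · refine le_trans ?_ (hfin P hP.ne_zero hn hB.le)
        refine (mul_le_of_le_one_right hκ.le (rpow_neg_le_one_of_one_le hM hν)).trans ?_
        exact (min_le_right _ _).trans (min_le_left _ _))
  obtain ⟨ν', hνν', hν'⟩ := EReal.lt_iff_exists_real_btwn.1 h
  have hlt : ν < ν' := by exact_mod_cast hνν'
  set c := κ ^ n * (n + 1 : ℝ) ^ (-ν) with hc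
  have hc0 : 0 < c := by positivity
  have hlarge : ∀ᶠ X : ℝ in atTop, c⁻¹ < X ^ (ν' - ν) :=
    (tendsto_rpow_atTop (by linarith)).eventually_gt_atTop _
  obtain ⟨X, ⟨Q, hQ0, hQdeg, hQc, hQ⟩, hXc, hX1⟩ :=
    ((frequently_of_lt_wOrd hν').and_eventually (hlarge.and (eventually_ge_atTop 1))).exists
  have hX0 : 0 < X := by linarith
  have h1 := hlow Q hQ0 hQdeg
  have hM := one_le_intMahler hQ0
  have h2 : c * X ^ (-ν) ≤ X ^ (-ν') := by
    calc c * X ^ (-ν) = κ ^ n * ((n + 1) * X) ^ (-ν) := by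
          rw [hc, Real.mul_rpow (by positivity) hX0.le]; ring
      _ ≤ κ ^ Q.natDegree * intMahler Q ^ (-ν) := by
          refine mul_le_mul (pow_le_pow_of_le_one hκ.le hκ1 hQdeg) ?_ (by positivity) (by positivity)
          exact Real.rpow_le_rpow_of_nonpos (by linarith) (intMahler_le hQdeg hQc) (by linarith)
      _ ≤ |aeval ζ Q| := h1
      _ ≤ _ := hQ
  have h3 : c * X ^ (ν' - ν) ≤ 1 := by
    have h4 : X ^ (ν' - ν) = X ^ (-ν) * X ^ ν' := by rw [← Real.rpow_add hX0]; ring_nf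
    have h5 : X ^ (-ν') * X ^ ν' = 1 := by rw [← Real.rpow_add hX0]; simp
    rw [h4, ← mul_assoc, ← h5]
    gcongr
  have h6 : 1 < c * X ^ (ν' - ν) := by
    rwa [inv_lt_iff_one_lt_mul₀ hc0, mul_comm] at hXc
  linarith

/-! ### Relations between the exponents -/

/-- With P and Q both of size about M and both values about M^(-ν), the resultant is of order at
most M^(m+n-1-ν), which tends to 0. -/
theorem not_eventually_of_irreducible {m n : ℕ} {ζ ν : ℝ} (hν : (m + n : ℝ) - 1 < ν)
    (hP : ∀ B : ℝ, ∃ P : ℤ[X], Irreducible P ∧ 1 ≤ P.natDegree ∧ P.natDegree ≤ m ∧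
      B ≤ intMahler P ∧ |aeval ζ P| ≤ intMahler P ^ (-ν)) :
    ¬ ∀ᶠ X : ℝ in atTop, ∃ Q, IsPolySolution n ζ X ν Q := by
  intro hev
  obtain ⟨C, hC, hres⟩ := one_le_of_not_dvd m n ζ
  set D := C * (2 ^ m) ^ n * (1 + (n + 2 : ℝ) ^ ν) with hD
  have hD0 : 0 < D := by positivity
  have hsmall : ∀ᶠ M : ℝ in atTop, M ^ (-(ν - (m + n - 1))) < D⁻¹ :=
    (tendsto_rpow_neg_atTop (by linarith)).eventually_lt_const (by positivity)
  obtain ⟨B₁, hB₁⟩ := eventually_atTop.1 hsmall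
  obtain ⟨X₀, hX₀⟩ := eventually_atTop.1 hev
  obtain ⟨P, hirr, h1, hm, hB, hPζ⟩ := hP (max B₁ ((n + 2) * X₀))
  have hM1 := one_le_intMahler hirr.ne_zero
  set M := intMahler P with hM
  have hM0 : 0 < M := by linarith
  have hn2 : (0 : ℝ) < n + 2 := by positivity
  -- The Mahler measure of Q is at most (n+1)X. Taking X = M/(n+2) makes this less than M, so P
  -- cannot divide Q.
  obtain ⟨Q, hQ0, hQdeg, hQc, hQζ⟩ := hX₀ (M / (n + 2)) (by
    rw [le_div_iff₀ hn2, mul_comm]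
    exact (le_max_right _ _).trans hB)
  have hndvd : ¬ P ∣ Q := fun hdvd => by
    have h2 := (intMahler_le_of_dvd hQ0 hdvd).trans (intMahler_le hQdeg hQc)
    rw [← hM, ← mul_div_assoc, le_div_iff₀ hn2] at h2
    nlinarith
  have hK : (1 : ℝ) ≤ 2 ^ m := one_le_pow₀ one_le_two
  have key := hres P Q hirr h1 hm hQdeg hndvd (2 ^ m * M) M (by nlinarith) hM1
    (abs_coeff_le_intMahler hirr.ne_zero hm) fun i => (hQc i).trans
      (div_le_self hM0.le (by linarith))
  have hlt : D * M ^ (-(ν - (m + n - 1))) < 1 := by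
    calc D * M ^ (-(ν - (m + n - 1))) < D * D⁻¹ := by
          gcongr
          exact hB₁ M ((le_max_left _ _).trans hB)
      _ = 1 := mul_inv_cancel₀ hD0.ne'
  refine absurd (key.trans ?_) (not_le.2 hlt)
  have hpow : M ^ (-(ν - (m + n - 1))) = M ^ n * M ^ m * (M ^ (-ν) / M) := by
    rw [← Real.rpow_natCast, ← Real.rpow_natCast, ← Real.rpow_add hM0, ← Real.rpow_sub_one hM0.ne',
      ← Real.rpow_add hM0]
    ring_nf
  have hdiv : (M / (n + 2)) ^ (-ν) = (n + 2 : ℝ) ^ ν * M ^ (-ν) := by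
    rw [Real.div_rpow hM0.le hn2.le, Real.rpow_neg hn2.le, div_inv_eq_mul, mul_comm]
  calc C * ((2 ^ m * M) ^ n * M ^ m * (|aeval ζ P| / (2 ^ m * M) + |aeval ζ Q| / M))
      ≤ C * ((2 ^ m * M) ^ n * M ^ m * (M ^ (-ν) / M + ((n + 2 : ℝ) ^ ν * M ^ (-ν)) / M)) := by
        rw [← hdiv]
        gcongr
        exact le_mul_of_one_le_left hM0.le hK
    _ = D * M ^ (-(ν - (m + n - 1))) := by
        rw [hpow, hD, mul_pow]; ring

theorem wHat_le_of_lt_wOrd {m n : ℕ} (hm : 1 ≤ m) {ζ : ℝ} (hζ : Transcendental ℚ ζ) {c : ℝ}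
    (hc : (m + n : ℝ) - 1 ≤ c) (h : (c : EReal) < wOrd (powers m ζ)) :
    wHat (powers n ζ) ≤ (c : EReal) := by
  by_contra! hcon
  obtain ⟨ν, hν, hlt⟩ := EReal.lt_iff_exists_real_btwn.1 (lt_min h hcon)
  have hcν : c < ν := by exact_mod_cast hν
  have hm' : (1 : ℝ) ≤ m := by exact_mod_cast hm
  have hn' : (0 : ℝ) ≤ n := n.cast_nonneg
  have hν0 : 0 ≤ ν := by linarith
  exact not_eventually_of_irreducible (m := m) (n := n) (ζ := ζ) (ν := ν) (by linarith)
    (fun B => exists_irreducible hζ hν0 (hlt.trans_le (min_le_left _ _))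
      (hasLowerBound_zero ζ hν0) B)
    (eventually_of_lt_wHat (hlt.trans_le (min_le_right _ _)))

/-- The predicates `p` and `q` isolate what is needed for P ∤ Q: a multiple of P among the
admissible Q is not smaller than P at ζ. The two applications differ only in this choice. -/
theorem mul_le_of_irreducible {n : ℕ} {ζ μ ν : ℝ} (hζ : Transcendental ℚ ζ) (hn : 1 ≤ n)
    (hμ : 0 < μ) (hμν : μ ≤ ν) {p q : ℤ[X] → Prop}
    (hdiv : ∀ P Q : ℤ[X], p P → q Q → Q ≠ 0 → Q.natDegree ≤ n → P ∣ Q → |aeval ζ P| ≤ |aeval ζ Q|)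
    (hP : ∀ B : ℝ, ∃ P : ℤ[X], p P ∧ Irreducible P ∧ 1 ≤ P.natDegree ∧ P.natDegree ≤ n ∧
      B ≤ intMahler P ∧ |aeval ζ P| ≤ intMahler P ^ (-ν))
    (hQ : ∀ᶠ X : ℝ in atTop, ∃ Q, IsPolySolution n ζ X μ Q ∧ q Q) :
    μ * (ν - n + 1) ≤ n * ν := by
  by_contra! hcon
  have hν : 0 < ν := by linarith
  obtain ⟨C, hC, hres⟩ := one_le_of_not_dvd n n ζ
  set D := 3 * C * (2 ^ n) ^ n with hD
  have hD0 : 0 < D := by positivity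
  -- The resultant is at most a constant times M^(n-1) X^n X^(-μ), where M ≤ X^(μ/ν). This is
  -- X^(-s), and s > 0 is the negated claim.
  set s := μ - n - (n - 1) * (μ / ν) with hs
  have hs0 : 0 < s := by
    have : s = (μ * (ν - n + 1) - n * ν) / ν := by rw [hs]; field_simp; ring
    rw [this]
    exact div_pos (by linarith) hν
  have hsmall : ∀ᶠ X : ℝ in atTop, X ^ (-s) < D⁻¹ :=
    (tendsto_rpow_neg_atTop hs0).eventually_lt_const (by positivity)
  obtain ⟨B, hB⟩ := eventually_atTop.1 (hsmall.and hQ)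
  obtain ⟨P, hpP, hirr, h1, hPn, hBM, hPζ⟩ := hP B
  have hM1 := one_le_intMahler hirr.ne_zero
  set M := intMahler P with hM
  have hM0 : 0 < M := by linarith
  have ht : 0 < |aeval ζ P| := abs_pos.2 (aeval_ne_zero_of_transcendental hζ hirr.ne_zero)
  set t := |aeval ζ P| with htdef
  -- Chosen so that X^(-μ) = t/2, hence |Q(ζ)| < |P(ζ)|.
  set X := (2 / t) ^ (1 / μ) with hX
  have hXμ : X ^ μ = 2 / t := by
    rw [hX, ← Real.rpow_mul (by positivity), one_div_mul_cancel hμ.ne', Real.rpow_one]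
  have hMν : M ^ ν ≤ 2 / t := by
    rw [Real.rpow_neg hM0.le] at hPζ
    have : M ^ ν ≤ 1 / t := by
      rw [le_div_iff₀ ht]
      calc M ^ ν * t ≤ M ^ ν * (M ^ ν)⁻¹ := by gcongr
        _ = 1 := mul_inv_cancel₀ (by positivity)
    exact this.trans (by gcongr; norm_num)
  have hX1 : 1 ≤ X :=
    Real.one_le_rpow ((Real.one_le_rpow hM1 hν.le).trans hMν) (by positivity)
  have hX0 : 0 < X := by linarith
  have hMX' : M ≤ X ^ (μ / ν) := by
    have h2 : (M ^ ν) ^ (1 / ν) ≤ (X ^ μ) ^ (1 / ν) := by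
      rw [hXμ]
      exact Real.rpow_le_rpow (by positivity) hMν (by positivity)
    rwa [← Real.rpow_mul hM0.le, ← Real.rpow_mul hX0.le, mul_one_div_cancel hν.ne', Real.rpow_one,
      mul_one_div] at h2
  have hMX : M ≤ X := by
    refine hMX'.trans ?_
    conv_rhs => rw [← Real.rpow_one X]
    exact Real.rpow_le_rpow_of_exponent_le hX1 ((div_le_one hν).2 hμν)
  obtain ⟨hlt, Q, ⟨hQ0, hQdeg, hQc, hQζ⟩, hqQ⟩ := hB X (hBM.trans hMX)
  have hXneg : t = 2 * X ^ (-μ) := by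
    rw [Real.rpow_neg hX0.le, hXμ, inv_div]; ring
  have hndvd : ¬ P ∣ Q := fun hdvd => by
    have := hdiv P Q hpP hqQ hQ0 hQdeg hdvd
    linarith
  have hK : (1 : ℝ) ≤ 2 ^ n := one_le_pow₀ one_le_two
  have key := hres P Q hirr h1 hPn hQdeg hndvd (2 ^ n * M) X (by nlinarith) hX1
    (abs_coeff_le_intMahler hirr.ne_zero hPn) hQc
  have hlt' : D * X ^ (-s) < 1 := by
    calc D * X ^ (-s) < D * D⁻¹ := by gcongr
      _ = 1 := mul_inv_cancel₀ hD0.ne'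
  refine absurd (key.trans ?_) (not_le.2 hlt')
  have hn1 : ((n - 1 : ℕ) : ℝ) = n - 1 := by rw [Nat.cast_sub hn, Nat.cast_one]
  have hpow : X ^ (-s) = (X ^ (μ / ν)) ^ (n - 1) * X ^ n * X ^ (-μ) := by
    rw [← Real.rpow_natCast, ← Real.rpow_natCast, ← Real.rpow_mul hX0.le, ← Real.rpow_add hX0,
      ← Real.rpow_add hX0, hn1, hs]
    ring_nf
  calc C * ((2 ^ n * M) ^ n * X ^ n * (t / (2 ^ n * M) + |aeval ζ Q| / X))
      ≤ C * ((2 ^ n * M) ^ n * X ^ n * (2 * X ^ (-μ) / M + X ^ (-μ) / M)) := by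
        rw [← hXneg]
        gcongr
        exact le_mul_of_one_le_left hM0.le hK
    _ = D * (M ^ (n - 1) * X ^ n * X ^ (-μ)) := by
        rw [hD, mul_pow, ← mul_pow_sub_one (by omega : n ≠ 0) M]
        field_simp
        ring
    _ ≤ D * X ^ (-s) := by
        rw [hpow]
        gcongr

theorem linearIndependent_powers (n : ℕ) {ζ : ℝ} (hζ : Transcendental ℚ ζ) :
    LinearIndependent ℚ (Fin.cons 1 (powers n ζ) : Fin (n + 1) → ℝ) := by
  have h : (Fin.cons 1 (powers n ζ) : Fin (n + 1) → ℝ) = (fun i : ℕ => ζ ^ i) ∘ Fin.val := by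
    ext i
    induction i using Fin.cases with
    | zero => simp
    | succ i => simp [powers]
  have hker : LinearMap.ker (aeval ζ : ℚ[X] →ₐ[ℚ] ℝ).toLinearMap = ⊥ :=
    LinearMap.ker_eq_bot.2 (transcendental_iff_injective.1 hζ)
  have hpow : LinearIndependent ℚ fun i : ℕ => ζ ^ i := by
    have hfun : (fun i : ℕ => ζ ^ i) =
        (aeval ζ : ℚ[X] →ₐ[ℚ] ℝ).toLinearMap ∘ basisMonomials ℚ := by
      ext i
      simp
    rw [hfun]
    exact (basisMonomials ℚ).linearIndependent.map' _ hker
  rw [h]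
  exact hpow.comp _ Fin.val_injective

theorem le_wHat_of_eventually {n : ℕ} {ζ μ : ℝ}
    (h : ∀ᶠ X : ℝ in atTop, ∃ Q, IsPolySolution n ζ X μ Q) : (μ : EReal) ≤ wHat (powers n ζ) := by
  rw [wHat_powers]
  exact le_sSup ⟨μ, h, rfl⟩

/-! ### Combining the conjecture with the resultant estimate. -/

theorem lt_geomSum_of_conjecture {n : ℕ} {ζ c μ : ℝ} (hSS : SchmidtSummererConjecture n)
    (hζ : Transcendental ℚ ζ) (hn : 1 ≤ n) (hnc : n < c) (hcμ : c < μ) {p q : ℤ[X] → Prop}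
    (hdiv : ∀ P Q : ℤ[X], p P → q Q → Q ≠ 0 → Q.natDegree ≤ n → P ∣ Q → |aeval ζ P| ≤ |aeval ζ Q|)
    {w₀ : EReal} (hw₀ : w₀ < wOrd (powers n ζ))
    (hP : ∀ ν : ℝ, 0 ≤ ν → w₀ < ν → (ν : EReal) < wOrd (powers n ζ) → ∀ B : ℝ, ∃ P : ℤ[X], p P ∧
      Irreducible P ∧ 1 ≤ P.natDegree ∧ P.natDegree ≤ n ∧
      B ≤ intMahler P ∧ |aeval ζ P| ≤ intMahler P ^ (-ν))
    (hQ : ∀ᶠ X : ℝ in atTop, ∃ Q, IsPolySolution n ζ X μ Q ∧ q Q) :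
    c < ∑ i ∈ Finset.range n, ((n - 1) / (c - n)) ^ i := by
  obtain ⟨μ', hcμ', hμ'μ⟩ := exists_between hcμ
  have hn0 : (1 : ℝ) ≤ n := by exact_mod_cast hn
  have hμ'0 : 0 < μ' := by linarith
  have hQ' : ∀ᶠ X : ℝ in atTop, ∃ Q, IsPolySolution n ζ X μ' Q ∧ q Q :=
    (hQ.and (eventually_ge_atTop 1)).mono fun X hX =>
      hX.1.imp fun Q hQ => ⟨hQ.1.of_le hμ'μ.le hX.2, hQ.2⟩
  have hhat : (μ' : EReal) < wHat (powers n ζ) :=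
    (EReal.coe_lt_coe_iff.2 hμ'μ).trans_le
      (le_wHat_of_eventually (hQ.mono fun X => Exists.imp fun Q hQ => hQ.1))
  have hord := hhat.trans_le (wHat_le_wOrd _)
  -- The largest ν permitted by `mul_le_of_irreducible`, obtained by solving μ'(ν-n+1) = nν.
  set T := μ' * (n - 1) / (μ' - n) with hT
  have hμn : 0 < μ' - n := by linarith
  have hwT : wOrd (powers n ζ) ≤ (T : EReal) := by
    by_contra! hlt
    obtain ⟨ν, hν, hνw⟩ := EReal.lt_iff_exists_real_btwn.1 (max_lt (max_lt hlt hord) hw₀)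
    have h1 : T < ν := by
      exact_mod_cast ((le_max_left _ _).trans (le_max_left _ _)).trans_lt hν
    have h2 : μ' < ν := by
      exact_mod_cast ((le_max_right _ _).trans (le_max_left _ _)).trans_lt hν
    have h3 := mul_le_of_irreducible hζ hn hμ'0 h2.le hdiv
      (hP ν (by linarith) ((le_max_right _ _).trans_lt hν) hνw) hQ'
    rw [hT, div_lt_iff₀ hμn] at h1
    linarith
  obtain ⟨ρ, hρ, hwρ, hμS⟩ := exists_ratio_of_lt_phi hn
    (ne_of_lt (hwT.trans_lt (EReal.coe_lt_top _)))
    (hhat.trans_le (hSS _ (linearIndependent_powers n hζ)).1)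
  set S := ∑ i ∈ Finset.range n, ρ ^ i with hS
  rw [hwρ, EReal.coe_le_coe_iff, hT, le_div_iff₀ hμn] at hwT
  -- From ρμ' ≤ ρS = wₙ ≤ T, dividing by μ' and using c < μ'.
  have hρle : ρ ≤ (n - 1) / (c - n) := by
    rw [le_div_iff₀ (by linarith)]
    have h1 : μ' * (ρ * (μ' - n)) ≤ μ' * (n - 1) := by
      refine le_trans ?_ hwT
      have : 0 ≤ ρ * (μ' - n) := by positivity
      nlinarith
    have h2 := le_of_mul_le_mul_left h1 hμ'0
    nlinarith
  calc c < S := hcμ'.trans hμS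
    _ ≤ _ := by rw [hS]; gcongr

theorem abs_aeval_le_of_mul {ζ : ℝ} (P : ℤ[X]) {R : ℤ[X]} (hR : R ≠ 0) (hdeg : R.natDegree = 0) :
    |aeval ζ P| ≤ |aeval ζ (P * R)| := by
  have h := intMahler_rpow_le_of_natDegree_eq_zero ζ le_rfl hR hdeg
  rw [neg_zero, Real.rpow_zero] at h
  rw [map_mul, abs_mul]
  exact le_mul_of_one_le_right (abs_nonneg _) h

theorem wStarHat_le_of_geomSum_le {n : ℕ} {ζ c : ℝ} (hSS : SchmidtSummererConjecture n)
    (hζ : Transcendental ℚ ζ) (hn : 1 ≤ n) (hnc : n < c)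
    (hc : ∑ i ∈ Finset.range n, (((n : ℝ) - 1) / (c - n)) ^ i ≤ c) :
    wStarHat n ζ ≤ (c : EReal) := by
  by_contra! hlt
  obtain ⟨μ, hcμ, hμ⟩ := EReal.lt_iff_exists_real_btwn.1 hlt
  have hcμ' : c < μ := by exact_mod_cast hcμ
  have hμ0 : 0 ≤ μ := by linarith [(n.cast_nonneg : (0 : ℝ) ≤ n)]
  have hQ := eventually_irreducible_of_lt_wStarHat hμ0 hμ
  have hw : ⊥ < wOrd (powers n ζ) :=
    ((EReal.bot_lt_coe μ).trans_le
      (le_wHat_of_eventually (hQ.mono fun X => Exists.imp fun Q hQ => hQ.1))).trans_le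
      (wHat_le_wOrd _)
  refine absurd (lt_geomSum_of_conjecture hSS hζ hn hnc hcμ' (p := Irreducible) (q := Irreducible)
    ?_ hw ?_ hQ) (not_lt.2 hc)
  -- Irreducible polynomials dividing one another are associated, so the cofactor is a unit.
  · rintro P Q hP hQ hQ0 - ⟨R, rfl⟩
    have hR := (hQ.isUnit_or_isUnit rfl).resolve_left hP.not_isUnit
    exact abs_aeval_le_of_mul P hR.ne_zero (natDegree_eq_zero_of_isUnit hR)
  · intro ν hν _ hνw B
    obtain ⟨P, h1, h2⟩ := exists_irreducible hζ hν hνw (hasLowerBound_zero ζ hν) B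
    exact ⟨P, h1, h1, h2⟩

theorem wHat_le_of_geomSum_le {n : ℕ} {ζ c : ℝ} (hSS : SchmidtSummererConjecture n)
    (hζ : Transcendental ℚ ζ) (hn : 1 ≤ n) (hnc : n < c)
    (hc : ∑ i ∈ Finset.range n, (((n : ℝ) - 1) / (c - n)) ^ i ≤ c)
    (hw : wOrd (powers (n - 1) ζ) < wOrd (powers n ζ)) :
    wHat (powers n ζ) ≤ (c : EReal) := by
  by_contra! hlt
  obtain ⟨μ, hcμ, hμ⟩ := EReal.lt_iff_exists_real_btwn.1 hlt
  have hcμ' : c < μ := by exact_mod_cast hcμ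
  have hQ := (eventually_of_lt_wHat hμ).mono fun X => Exists.imp fun Q hQ => And.intro hQ trivial
  refine absurd (lt_geomSum_of_conjecture hSS hζ hn hnc hcμ' (p := fun P => P.natDegree = n)
    (q := fun _ => True) ?_ hw ?_ hQ) (not_lt.2 hc)
  -- P already has the maximal degree n, so the cofactor is a non-zero integer constant.
  · rintro P Q hP - hQ0 hQn ⟨R, rfl⟩
    have hR := right_ne_zero_of_mul hQ0
    refine abs_aeval_le_of_mul P hR ?_
    rw [natDegree_mul (left_ne_zero_of_mul hQ0) hR, hP] at hQn
    omega
  · intro ν hν hwν hνw B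
    obtain ⟨P, h1, h2, h3, h4⟩ := exists_irreducible hζ hν hνw (hasLowerBound_of_wOrd_lt hwν) B
    exact ⟨P, by omega, h1, by omega, h3, h4⟩

/-! ### Numerical estimates -/

/-- The strictly convex function e^x - 1 - 2x vanishes at 0, so it is negative on (0, y) when it is
at most 0 at y. Uniqueness and numerical location of the positive root both follow. -/
theorem exp_lt_of_exp_le {x y : ℝ} (hx : 0 < x) (hxy : x < y) (hy : Real.exp y ≤ 1 + 2 * y) :
    Real.exp x < 1 + 2 * x := by
  have hy0 : 0 < y := hx.trans hxy
  have h := strictConvexOn_exp.2 (Set.mem_univ y) (Set.mem_univ 0) hy0.ne'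
    (div_pos hx hy0) (sub_pos.2 ((div_lt_one hy0).2 hxy)) (by ring)
  simp only [smul_eq_mul, mul_zero, add_zero, Real.exp_zero, mul_one, div_mul_cancel₀ x hy0.ne'] at h
  calc Real.exp x < x / y * Real.exp y + (1 - x / y) := h
    _ ≤ x / y * (1 + 2 * y) + (1 - x / y) := by gcongr
    _ = 1 + 2 * x := by field_simp; ring

theorem exp_lower_lt : Real.exp 1.2563 < 1 + 2 * 1.2563 := by
  have h1 := Real.exp_one_lt_d9
  have h2 := Real.exp_bound' (x := 0.2563) (by norm_num) (by norm_num) (n := 6) (by norm_num)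
  have h3 : Real.exp 1.2563 = Real.exp 1 * Real.exp 0.2563 := by rw [← Real.exp_add]; norm_num
  norm_num [Finset.sum_range_succ, Nat.factorial] at h2
  rw [h3]
  have h4 : Real.exp 0.2563 ≤ 1.29218 := by norm_num; linarith
  calc Real.exp 1 * Real.exp 0.2563 ≤ 2.7182818286 * 1.29218 := by gcongr
    _ < _ := by norm_num

theorem lt_exp_upper : 1 + 2 * 1.2565 < Real.exp 1.2565 := by
  have h1 := Real.exp_one_gt_d9
  have h2 := Real.sum_le_exp_of_nonneg (x := 0.2565) (by norm_num) 6
  have h3 : Real.exp 1.2565 = Real.exp 1 * Real.exp 0.2565 := by rw [← Real.exp_add]; norm_num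
  norm_num [Finset.sum_range_succ, Nat.factorial] at h2
  rw [h3]
  have h4 : 1.29238 ≤ Real.exp 0.2565 := by norm_num; linarith
  calc (1 + 2 * 1.2565 : ℝ) < 2.7182818283 * 1.29238 := by norm_num
    _ ≤ _ := by gcongr

theorem mem_Ioo_of_exp_eq {δ : ℝ} (hδ : 0 < δ) (h : Real.exp δ = 1 + 2 * δ) :
    δ ∈ Set.Ioo (1.2563 : ℝ) 1.2565 := by
  constructor
  · by_contra! hle
    rcases hle.eq_or_lt with rfl | hlt
    · exact absurd h exp_lower_lt.ne
    · exact absurd h (exp_lt_of_exp_le hδ hlt exp_lower_lt.le).ne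
  · by_contra! hle
    rcases hle.eq_or_lt with rfl | hlt
    · exact absurd h lt_exp_upper.ne'
    · exact absurd lt_exp_upper (exp_lt_of_exp_le (by norm_num) hlt h.le).not_gt

theorem exists_exp_eq : ∃ δ : ℝ, 0 < δ ∧ Real.exp δ = 1 + 2 * δ := by
  have hcont : ContinuousOn (fun x : ℝ => Real.exp x - (1 + 2 * x)) (Set.Icc 1.2563 1.2565) := by
    fun_prop
  have h0 : (0 : ℝ) ∈ Set.Icc (Real.exp 1.2563 - (1 + 2 * 1.2563))
      (Real.exp 1.2565 - (1 + 2 * 1.2565)) :=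
    ⟨by linarith [exp_lower_lt], by linarith [lt_exp_upper]⟩
  obtain ⟨δ, hδ, h⟩ := intermediate_value_Icc (by norm_num) hcont h0
  exact ⟨δ, lt_of_lt_of_le (by norm_num) hδ.1, by dsimp only at h; linarith⟩

theorem exp_eq_unique {x y : ℝ} (hx : 0 < x) (hy : 0 < y) (hxe : Real.exp x = 1 + 2 * x)
    (hye : Real.exp y = 1 + 2 * y) : x = y := by
  rcases lt_trichotomy x y with h | h | h
  · exact absurd hxe (exp_lt_of_exp_le hx h hye.le).ne
  · exact h
  · exact absurd hye (exp_lt_of_exp_le hy h hxe.le).ne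

/-- The substitution δ = 1/y - 1/2 turns the equation for τ into e^δ = 1 + 2δ. -/
theorem mul_exp_eq_iff {y : ℝ} (hy : 0 < y) :
    y * Real.exp (1 / y) = 2 * √(Real.exp 1) ↔
      Real.exp (1 / y - 1 / 2) = 1 + 2 * (1 / y - 1 / 2) := by
  rw [← Real.exp_half, Real.exp_sub, div_eq_iff (Real.exp_pos _).ne']
  constructor
  · intro h
    field_simp
    linear_combination h
  · intro h
    rw [h]
    field_simp
    ring

theorem existsUnique_mul_exp_eq :
    ∃! y : ℝ, y ∈ Set.Ioo (0 : ℝ) 1 ∧ y * Real.exp (1 / y) = 2 * √(Real.exp 1) := by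
  obtain ⟨δ, hδ, h⟩ := exists_exp_eq
  have hmem := mem_Ioo_of_exp_eq hδ h
  have hpos : 0 < 1 / 2 + δ := by linarith
  refine ⟨1 / (1 / 2 + δ), ⟨⟨by positivity, ?_⟩, ?_⟩, ?_⟩
  · rw [div_lt_one hpos]; linarith [hmem.1]
  · rw [mul_exp_eq_iff (by positivity), one_div_one_div, add_sub_cancel_left]
    exact h
  · rintro y ⟨⟨hy0, hy1⟩, hy⟩
    rw [mul_exp_eq_iff hy0] at hy
    have h1 : 1 < 1 / y := by rwa [lt_div_iff₀ hy0, one_mul]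
    have := exp_eq_unique (by linarith) hδ hy h
    rw [← this, add_sub_cancel, one_div_one_div]

theorem geomSum_le_of_ten_le {n : ℕ} (hn : 10 ≤ n) :
    ∑ i ∈ Finset.range n, (((n : ℝ) - 1) / (2 * n - 2 - n)) ^ i ≤ 2 * n - 2 := by
  have hn' : (10 : ℝ) ≤ n := by exact_mod_cast hn
  have h2 : (0 : ℝ) < n - 2 := by linarith
  have hG : ((n : ℝ) - 1) / (2 * n - 2 - n) = 1 + 1 / (n - 2) := by
    rw [show (2 * n - 2 - n : ℝ) = n - 2 by ring]
    field_simp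
    ring
  rw [hG, geom_sum_eq (by simpa using h2.ne'), add_sub_cancel_left, div_le_iff₀ (by positivity),
    mul_one_div, sub_le_iff_le_add]
  -- From 23 on, n/(n-2) ≤ 1.0953 and e^1.0953 < 3, which suffices since (2n-2)/(n-2) + 1 > 3. The
  -- smaller n are checked directly.
  rcases lt_or_ge n 23 with h | h
  · interval_cases n <;> norm_num
  · have h23 : (23 : ℝ) ≤ n := by exact_mod_cast h
    calc (1 + 1 / ((n : ℝ) - 2)) ^ n ≤ Real.exp (1 / (n - 2)) ^ n := by
          gcongr
          linarith [Real.add_one_le_exp (1 / ((n : ℝ) - 2))]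
      _ = Real.exp (n * (1 / (n - 2))) := by rw [← Real.exp_nat_mul]
      _ ≤ Real.exp (1 + 0.0953) := by
          gcongr
          rw [mul_one_div, div_le_iff₀ h2]
          linarith
      _ ≤ 3 := by
          have h3 := Real.exp_bound' (x := 0.0953) (by norm_num) (by norm_num) (n := 4) (by norm_num)
          norm_num [Finset.sum_range_succ, Nat.factorial] at h3
          have h4 : Real.exp 0.0953 ≤ 1.1 := by norm_num; linarith
          rw [Real.exp_add]
          calc Real.exp 1 * Real.exp 0.0953 ≤ 2.7182818286 * 1.1 := by
                gcongr
                exact Real.exp_one_lt_d9.le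
            _ ≤ 3 := by norm_num
      _ ≤ (2 * n - 2) / (n - 2) + 1 := by
          have : (2 : ℝ) ≤ (2 * n - 2) / (n - 2) := by rw [le_div_iff₀ h2]; linarith
          linarith

/-- The ratio is 1 + d/(n-1-d), whose n-th power is at most exp(d/(1-(1+d)/n)), with limit e^d.
After division by n the claim becomes in the limit e^d - 1 < 2d, which is strict. -/
theorem eventually_geomSum_le {d : ℝ} (hd : 0 < d) (hexp : Real.exp d < 1 + 2 * d) :
    ∀ᶠ n : ℕ in atTop,
      ∑ i ∈ Finset.range n, (((n : ℝ) - 1) / (2 * n - 1 - d - n)) ^ i ≤ 2 * n - 1 - d := by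
  have hinv : Tendsto (fun n : ℕ => (1 + d) / (n : ℝ)) atTop (nhds 0) :=
    tendsto_const_div_atTop_nhds_zero_nat _
  have h1 : Tendsto (fun n : ℕ => 1 - (1 + d) / (n : ℝ)) atTop (nhds 1) := by
    simpa using hinv.const_sub 1
  have hl : Tendsto (fun n : ℕ => (Real.exp (d / (1 - (1 + d) / n)) - 1) *
      (1 - (1 + d) / (n : ℝ))) atTop (nhds (Real.exp d - 1)) := by
    have := ((Real.continuous_exp.tendsto _).comp ((tendsto_const_nhds (x := d)).div h1 one_ne_zero)).sub_const 1
    simpa using this.mul h1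
  have hr : Tendsto (fun n : ℕ => d * (2 - (1 + d) / (n : ℝ))) atTop (nhds (2 * d)) := by
    have := (hinv.const_sub 2).const_mul d
    rwa [sub_zero, mul_comm d 2] at this
  obtain ⟨N, hN⟩ := exists_nat_gt (1 + d)
  filter_upwards [hl.eventually_lt hr (by linarith), eventually_ge_atTop N] with n hlt hnN
  have hn : 1 + d < n := hN.trans_le (by exact_mod_cast hnN)
  have hn0 : (0 : ℝ) < n := by linarith
  have hpos : (0 : ℝ) < n - 1 - d := by linarith
  have hG : ((n : ℝ) - 1) / (2 * n - 1 - d - n) = 1 + d / (n - 1 - d) := by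
    rw [show (2 * n - 1 - d - n : ℝ) = n - 1 - d by ring]
    field_simp
    ring
  have hdiv : d / (1 - (1 + d) / n) = n * (d / (n - 1 - d)) := by
    have : 1 - (1 + d) / (n : ℝ) = (n - 1 - d) / n := by field_simp; ring
    rw [this]
    field_simp
  have hpow : (1 + d / (n - 1 - d)) ^ n ≤ Real.exp (d / (1 - (1 + d) / n)) := by
    rw [hdiv, Real.exp_nat_mul]
    gcongr
    linarith [Real.add_one_le_exp (d / ((n : ℝ) - 1 - d))]
  rw [hG, geom_sum_eq (by simpa using ⟨hd.ne', hpos.ne'⟩), add_sub_cancel_left, div_le_iff₀ (by positivity)]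
  have h2 : 1 - (1 + d) / (n : ℝ) = (n - 1 - d) / n := by field_simp; ring
  calc (1 + d / (n - 1 - d)) ^ n - 1 ≤ Real.exp (d / (1 - (1 + d) / n)) - 1 := by gcongr
    _ = (Real.exp (d / (1 - (1 + d) / n)) - 1) * (1 - (1 + d) / n) * (n / (n - 1 - d)) := by
        rw [h2]; field_simp
    _ ≤ d * (2 - (1 + d) / n) * (n / (n - 1 - d)) := by gcongr
    _ = _ := by field_simp; ring

/-! ### The bounds for the uniform exponent and the final assembly. -/

theorem wHat_le_two_mul_sub_two {ζ : ℝ} (hζ : Transcendental ℚ ζ) {n : ℕ} (hn : 10 ≤ n)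
    (hSS : SchmidtSummererConjecture n) : wHat (powers n ζ) ≤ ((2 * (n : ℝ) - 2 : ℝ) : EReal) := by
  have hn' : (10 : ℝ) ≤ n := by exact_mod_cast hn
  by_contra! hlt
  refine absurd (wHat_le_of_geomSum_le hSS hζ (by omega) (by linarith) (geomSum_le_of_ten_le hn)
    ?_) (not_le.2 hlt)
  refine lt_of_le_of_lt ?_ (hlt.trans_le (wHat_le_wOrd _))
  -- If wₙ₋₁ is as large as wₙ, hence above 2n-2 = (n-1)+n-1, the lower-degree estimate with m = n-1
  -- applies.
  by_contra! hw
  refine absurd (wHat_le_of_lt_wOrd (by omega) hζ ?_ hw) (not_le.2 hlt)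
  rw [Nat.cast_sub (by omega), Nat.cast_one]
  linarith

/-- Unless `wₙ₋₂ < wₙ₋₁ = wₙ`, either `wₙ₋₁ < wₙ` or the three exponents agree. -/
theorem wHat_le_of_not_jump {ζ c : ℝ} (hζ : Transcendental ℚ ζ) {n : ℕ} (hn : 3 ≤ n)
    (hSS : SchmidtSummererConjecture n) (hnc : n < c) (hc : 2 * (n : ℝ) - 3 ≤ c)
    (hsum : ∑ i ∈ Finset.range n, (((n : ℝ) - 1) / (c - n)) ^ i ≤ c)
    (hw : ¬ (wOrd (powers (n - 2) ζ) < wOrd (powers (n - 1) ζ) ∧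
      wOrd (powers (n - 1) ζ) = wOrd (powers n ζ))) :
    wHat (powers n ζ) ≤ (c : EReal) := by
  rcases (wOrd_powers_mono (Nat.sub_le n 1) ζ).lt_or_eq with h | h
  · exact wHat_le_of_geomSum_le hSS hζ (by omega) hnc hsum h
  · have h2 : wOrd (powers n ζ) ≤ wOrd (powers (n - 2) ζ) := by
      rw [← h]
      exact not_lt.1 fun h' => hw ⟨h', h⟩
    by_contra! hlt
    refine absurd (wHat_le_of_lt_wOrd (m := n - 2) (by omega) hζ ?_
      ((hlt.trans_le (wHat_le_wOrd _)).trans_le h2)) (not_le.2 hlt)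
    rw [Nat.cast_sub (by omega), Nat.cast_ofNat]
    linarith
end UniformApprox

theorem theorem3p1
    (hSS : ∀ n : ℕ, 2 ≤ n → UniformApprox.SchmidtSummererConjecture n) :
    (∃! y : ℝ, y ∈ Set.Ioo (0 : ℝ) 1 ∧ y * Real.exp (1 / y) = 2 * √(Real.exp 1)) ∧
    (∀ τ Δ : ℝ, τ ∈ Set.Ioo (0 : ℝ) 1 → τ * Real.exp (1 / τ) = 2 * √(Real.exp 1) →
      Δ = Real.log (2 / τ) + 1 →
      |τ - 0.5693| < 0.0001 ∧ |Δ - 2.2564| < 0.0001 ∧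
      ∀ ε : ℝ, 0 < ε → ∃ n₀ : ℕ, 3 ≤ n₀ ∧ ∀ ζ : ℝ, Transcendental ℚ ζ → ∀ n : ℕ, n₀ ≤ n →
        UniformApprox.wStarHat n ζ ≤ ((2 * (n : ℝ) - Δ + ε : ℝ) : EReal) ∧
        (¬ (UniformApprox.wOrd (UniformApprox.powers (n - 2) ζ) <
              UniformApprox.wOrd (UniformApprox.powers (n - 1) ζ) ∧
            UniformApprox.wOrd (UniformApprox.powers (n - 1) ζ) =
              UniformApprox.wOrd (UniformApprox.powers n ζ)) →
          UniformApprox.wHat (UniformApprox.powers n ζ) ≤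
            ((2 * (n : ℝ) - Δ + ε : ℝ) : EReal))) ∧
    (∀ ζ : ℝ, Transcendental ℚ ζ → ∀ n : ℕ, 10 ≤ n →
      UniformApprox.wHat (UniformApprox.powers n ζ) ≤ ((2 * (n : ℝ) - 2 : ℝ) : EReal)) := by
  refine ⟨UniformApprox.existsUnique_mul_exp_eq, ?_, fun ζ hζ n hn =>
    UniformApprox.wHat_le_two_mul_sub_two hζ hn (hSS n (by omega))⟩
  rintro τ Δ ⟨hτ0, hτ1⟩ hτ hΔ
  have hτinv : 1 < 1 / τ := by rwa [lt_div_iff₀ hτ0, one_mul]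
  obtain ⟨δ, hδ⟩ : ∃ δ, δ = 1 / τ - 1 / 2 := ⟨_, rfl⟩
  have hexp : Real.exp δ = 1 + 2 * δ := by
    rw [hδ]
    exact (UniformApprox.mul_exp_eq_iff hτ0).1 hτ
  have hδ0 : 0 < δ := by linarith
  obtain ⟨hlow, hupp⟩ := UniformApprox.mem_Ioo_of_exp_eq hδ0 hexp
  have hΔδ : Δ = δ + 1 := by
    have h : 2 / τ = Real.exp δ := by
      rw [hexp, hδ]
      ring
    rw [hΔ, h, Real.log_exp]
  have hmul : τ * (1 / 2 + δ) = 1 := by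
    rw [hδ]
    field_simp
    ring
  refine ⟨?_, ?_, fun ε hε => ?_⟩
  · rw [abs_sub_lt_iff]
    constructor <;> nlinarith
  · rw [abs_sub_lt_iff]
    constructor <;> linarith
  -- Moving from δ to d = δ - η makes e^d < 1 + 2d strict at the cost of at most ε. The cap 1/4
  -- keeps d positive.
  obtain ⟨η, hη⟩ : ∃ η, η = min ε (1 / 4) := ⟨_, rfl⟩
  have hη0 : 0 < η := hη ▸ lt_min hε (by norm_num)
  have hηε : η ≤ ε := hη ▸ min_le_left _ _
  have hη4 : η ≤ 1 / 4 := hη ▸ min_le_right _ _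
  have hd := UniformApprox.exp_lt_of_exp_le (x := δ - η) (y := δ) (by linarith) (by linarith) hexp.le
  obtain ⟨N, hN⟩ := eventually_atTop.1
    (UniformApprox.eventually_geomSum_le (d := δ - η) (by linarith) hd)
  refine ⟨max N 3, le_max_right _ _, fun ζ hζ n hn => ?_⟩
  have hn3 : 3 ≤ n := (le_max_right _ _).trans hn
  have hn3' : (3 : ℝ) ≤ n := by exact_mod_cast hn3
  have hsum := hN n ((le_max_left _ _).trans hn)
  have hconj := hSS n (by omega)
  have hle : ((2 * (n : ℝ) - 1 - (δ - η) : ℝ) : EReal) ≤ ((2 * (n : ℝ) - Δ + ε : ℝ) : EReal) := by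
    rw [EReal.coe_le_coe_iff]
    linarith
  exact ⟨(UniformApprox.wStarHat_le_of_geomSum_le hconj hζ (by omega) (by linarith) hsum).trans hle,
    fun hw => (UniformApprox.wHat_le_of_not_jump hζ hn3 hconj (by linarith) (by linarith) hsum
      hw).trans hle⟩
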